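/- **Theorem (Symmetric Testers Lower Bound).** Let $[n]=\{1,\dots,n\}$, let $U_n$ be the uniform distribution on $[n]$, and let $\mathrm{TV}(\mathbf p,\mathbf q)=\frac12\sum_{x\in[n]}|\mathbf p_x-\mathbf q_x|$. A randomized algorithm $\mathcal A(\cdot\,;r)$ with random seed $r$ that maps a tuple of $m$ samples in $[n]$ to accept or reject solves *$(n,\varepsilon,\rho)$-replicable uniformity testing* if - for every distribution $\mathbf p$ on $[n]$, $\Pr_{r,T,T'}[\mathcal A(T;r)=\mathcal A(T';r)]\ge 1-\rho$, where $T,T'$ are independent tuples of $m$ i.i.d. samples from $\mathbf p$, independent of the seed $r$; - if $\mathbf p=U_n$, it accepts with probability at least $1-\rho$ (over $r$ and the samples); - if $\mathrm{TV}(\mathbf p,U_n)\ge\varepsilon$, it rejects with probability at least $1-\rho$. It is *symmetric* if for every fixed seed $r$, every permutation $\pi$ of $[n]$ and all samples, $\mathcal A(\pi(x_1),\dots,\pi(x_m);r)=\mathcal A(x_1,\dots,x_m;r)$. There is an absolute constant $k\in\mathbb N$ such that for every $\rho_0<1/2$ there is a constant $c>0$, depending only on $\rho_0$, with the following property: for all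 integers $n\ge 2$, all $\varepsilon\in(0,1/2)$ and all $\rho\in(0,\rho_0]$, every symmetric algorithm that solves $(n,\varepsilon,\rho)$-replicable uniformity testing with $m$ samples satisfies $$m\;\ge\;\frac{c}{\log^k(n/\rho)}\left(\frac{\sqrt n}{\varepsilon^2\rho}+\frac1{\rho^2\varepsilon^2}\right).$$ That is, $m=\tilde\Omega\left(\frac{\sqrt n}{\varepsilon^2\rho}+\frac{1}{\rho^2\varepsilon^2}\right)$, where $\tilde\Omega$ hides factors polylogarithmic in $n$ and $1/\rho$. -/

import Mathlib

open MeasureTheory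

universe u

namespace RepUnif

/-- Total variation distance between two distributions on `[n]`. -/
noncomputable def tvDist {n : ℕ} (p q : PMF (Fin n)) : ℝ :=
  (1 / 2) * ∑ x : Fin n, |(p x).toReal - (q x).toReal|

/-- The law of `m` i.i.d. samples drawn from `p`. -/
noncomputable def sampleLaw {n : ℕ} (p : PMF (Fin n)) (m : ℕ) : Measure (Fin m → Fin n) :=
  Measure.pi (fun _ => p.toMeasure)

/-- A randomized algorithm that reads `m` samples from `[n]` and answers accept (`true`) or
reject (`false`). The internal randomness is a seed drawn from an arbitrary probability space;
for a fixed seed `r`, `run r` is a deterministic function of the samples. -/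
structure Tester (n m : ℕ) where
  /-- The space of random seeds. -/
  Seed : Type u
  /-- The σ-algebra on the seeds. -/
  seedSpace : MeasurableSpace Seed
  /-- The law of the seed. -/
  seedLaw : Measure Seed
  /-- The law of the seed is a probability measure. -/
  isProb : IsProbabilityMeasure seedLaw
  /-- The answer on a given seed and sample tuple. -/
  run : Seed → (Fin m → Fin n) → Bool
  /-- For a fixed sample tuple the answer is a random variable. -/
  measurable_run : ∀ T, Measurable fun r => run r T

attribute [instance] Tester.seedSpace Tester.isProb

namespace Tester

variable {n m : ℕ}

/-- Probability, over the seed and the samples from `p`, that the answer is `b`. -/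
noncomputable def probAnswer (A : Tester.{u} n m) (p : PMF (Fin n)) (b : Bool) : ℝ :=
  (A.seedLaw.prod (sampleLaw p m)).real {ω | A.run ω.1 ω.2 = b}

/-- `ρ`-replicability: for every distribution, two runs that share the seed and use independent
sample tuples give the same answer with probability at least `1 - ρ`. -/
def Replicable (A : Tester.{u} n m) (ρ : ℝ) : Prop :=
  ∀ p : PMF (Fin n),
    1 - ρ ≤ (A.seedLaw.prod ((sampleLaw p m).prod (sampleLaw p m))).real
      {ω | A.run ω.1 ω.2.1 = A.run ω.1 ω.2.2}

/-- Solving `(n, ε, ρ)`-replicable uniformity testing. -/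
structure SolvesUniformity [NeZero n] (A : Tester.{u} n m) (ε ρ : ℝ) : Prop where
  replicable : A.Replicable ρ
  accepts : 1 - ρ ≤ A.probAnswer (PMF.uniformOfFintype (Fin n)) true
  rejects : ∀ p : PMF (Fin n), ε ≤ tvDist p (PMF.uniformOfFintype (Fin n)) →
    1 - ρ ≤ A.probAnswer p false

/-- For every fixed seed the answer is invariant under relabelling of `[n]`. -/
def Symmetric (A : Tester.{u} n m) : Prop :=
  ∀ (r : A.Seed) (π : Equiv.Perm (Fin n)) (T : Fin m → Fin n),
    A.run r (fun i => π (T i)) = A.run r T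

end Tester

end RepUnif

/-! Split `[n]` into `N` pairs, with one leftover element if `n` is odd, and bias every pair by the
same `ξ = tanh t`: this gives a path of distributions starting at the uniform one. A symmetric test
cannot tell which element of a pair is heavy, so its acceptance probability sees the path only
through flip-invariant events.

Along the path, the derivative of a flip-invariant acceptance probability is its correlation with
the score projected onto flip-invariant functions (`hasDerivAt_iidSum`). The projection replaces the
imbalance `d` of a pair by `d * tanh (t * d)`. By Efron–Stein the projected score has variance `O(m
* min(1, min(t,1)^2 * m / N))` (`iidSum_statistic_sq_le`). Hence, for each seed, the acceptance
probability `f` is `B`-Lipschitz in `t`, with `B` the square root of this bound.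

Replicability makes the seed average of `2 f (1 - f)` at most `ρ` at every point of the path, while
correctness makes the average of `f` drop by a constant `D` between its ends. Since `f` moves at
speed at most `B` and spends little weight away from `0` and `1`, a path of length `s` satisfies
`D^2 ≤ 3 B ρ s` (`sq_le_of_replicable`). With `s` of order `ε`, the bound `B ≲ √m` gives `m ≳ 1 /
(ρ^2 ε^2)`, and `B ≲ ε m / √N` gives `m ≳ √n / (ε^2 ρ)`.

For `ε` near `1/2` the far distribution is `ξ = 1`, at `t = ∞`. The path is then stopped at `s` of
order `log (n / ρ)`, where `m` samples hardly notice the truncation; this is the only source of the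
logarithm. -/

namespace RepUnif

/-! ### Expectations under finite product weights and the Efron–Stein inequality. -/

section IidSum

variable {X : Type*} [Fintype X]

/-- The expectation of `F` under `m` i.i.d. draws with weights `p`. -/
noncomputable def iidSum (p : X → ℝ) {m : ℕ} (F : (Fin m → X) → ℝ) : ℝ :=
  ∑ T, (∏ i, p (T i)) * F T

lemma iidSum_insertNth (p : X → ℝ) {m : ℕ} (i : Fin (m + 1)) (F : (Fin (m + 1) → X) → ℝ) :
    iidSum p F = ∑ x, p x * iidSum p fun T => F (i.insertNth x T) := by
  unfold iidSum
  rw [← (Fin.insertNthEquiv (fun _ => X) i).sum_comp, Fintype.sum_prod_type]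
  refine Finset.sum_congr rfl fun x _ => ?_
  rw [Finset.mul_sum]
  refine Finset.sum_congr rfl fun T _ => ?_
  rw [Fin.prod_univ_succAbove _ i]
  simp [Fin.insertNthEquiv, mul_assoc]

lemma iidSum_zero (p : X → ℝ) (F : (Fin 0 → X) → ℝ) : iidSum p F = F Fin.elim0 := by
  unfold iidSum
  rw [Fintype.sum_unique]
  simp only [Finset.univ_eq_empty, Finset.prod_empty, one_mul]
  congr 1

lemma iidSum_add (p : X → ℝ) {m : ℕ} (F G : (Fin m → X) → ℝ) :
    iidSum p (fun T => F T + G T) = iidSum p F + iidSum p G := by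
  simp [iidSum, mul_add, Finset.sum_add_distrib]

lemma iidSum_const_mul (p : X → ℝ) {m : ℕ} (c : ℝ) (F : (Fin m → X) → ℝ) :
    iidSum p (fun T => c * F T) = c * iidSum p F := by
  simp only [iidSum, Finset.mul_sum]
  exact Finset.sum_congr rfl fun T _ => by ring

lemma iidSum_sum (p : X → ℝ) {m : ℕ} {ι : Type*} (s : Finset ι) (F : ι → (Fin m → X) → ℝ) :
    iidSum p (fun T => ∑ j ∈ s, F j T) = ∑ j ∈ s, iidSum p (F j) := by
  simp only [iidSum, Finset.mul_sum]
  rw [Finset.sum_comm]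

lemma iidSum_mono {p : X → ℝ} (hp : ∀ x, 0 ≤ p x) {m : ℕ} {F G : (Fin m → X) → ℝ}
    (h : ∀ T, F T ≤ G T) : iidSum p F ≤ iidSum p G :=
  Finset.sum_le_sum fun T _ =>
    mul_le_mul_of_nonneg_left (h T) (Finset.prod_nonneg fun _ _ => hp _)

lemma iidSum_nonneg {p : X → ℝ} (hp : ∀ x, 0 ≤ p x) {m : ℕ} {F : (Fin m → X) → ℝ}
    (h : ∀ T, 0 ≤ F T) : 0 ≤ iidSum p F :=
  Finset.sum_nonneg fun T _ => mul_nonneg (Finset.prod_nonneg fun _ _ => hp _) (h T)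

lemma iidSum_const {p : X → ℝ} (hp : ∑ x, p x = 1) {m : ℕ} (c : ℝ) :
    iidSum p (fun _ : Fin m → X => c) = c := by
  induction m with
  | zero => rw [iidSum_zero]
  | succ m ih =>
    rw [iidSum_insertNth p 0]
    simp only [ih]
    rw [← Finset.sum_mul, hp, one_mul]

lemma sq_iidSum_le {p : X → ℝ} (hp : ∀ x, 0 ≤ p x) (hp1 : ∑ x, p x = 1) {m : ℕ}
    (F : (Fin m → X) → ℝ) : iidSum p F ^ 2 ≤ iidSum p fun T => F T ^ 2 := by
  have h := iidSum_nonneg hp fun T => sq_nonneg (F T - iidSum p F)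
  have e : (fun T => (F T - iidSum p F) ^ 2)
      = fun T => F T ^ 2 + ((-2 * iidSum p F) * F T + iidSum p F ^ 2) := by
    funext T; ring
  rw [e, iidSum_add, iidSum_add, iidSum_const_mul, iidSum_const hp1] at h
  nlinarith

lemma variance_le_of_const {p : X → ℝ} (hp1 : ∑ x, p x = 1) (f : X → ℝ) (c : ℝ) :
    ∑ x, p x * f x ^ 2 - (∑ x, p x * f x) ^ 2 ≤ ∑ x, p x * (f x - c) ^ 2 := by
  have e : ∑ x, p x * (f x - c) ^ 2
      = ∑ x, p x * f x ^ 2 - 2 * c * ∑ x, p x * f x + c ^ 2 * ∑ x, p x := by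
    rw [Finset.mul_sum, Finset.mul_sum, ← Finset.sum_sub_distrib, ← Finset.sum_add_distrib]
    exact Finset.sum_congr rfl fun x _ => by ring
  rw [e, hp1]
  nlinarith [sq_nonneg (∑ x, p x * f x - c)]

/-- The Efron–Stein inequality: `R i` approximates `F` without using the `i`-th sample. -/
theorem efron_stein {p : X → ℝ} (hp : ∀ x, 0 ≤ p x) (hp1 : ∑ x, p x = 1) {m : ℕ}
    (F : (Fin m → X) → ℝ) (R : Fin m → (Fin m → X) → ℝ)
    (hR : ∀ i T x, R i (Function.update T i x) = R i T) :
    iidSum p (fun T => F T ^ 2) - iidSum p F ^ 2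
      ≤ ∑ i, iidSum p fun T => (F T - R i T) ^ 2 := by
  induction m with
  | zero => simp [iidSum_zero]
  | succ m ih =>
    rw [Fin.sum_univ_succ]
    have hcons : ∀ G : (Fin (m + 1) → X) → ℝ,
        iidSum p G = ∑ x, p x * iidSum p fun T : Fin m → X => G (Fin.cons x T) := fun G => by
      simpa using iidSum_insertNth p 0 G
    -- Law of total variance on the first sample: `htail` bounds the mean conditional variance by
    -- induction, `hhead` the variance of the conditional mean.
    have htail : ∑ x, p x * (iidSum p (fun T : Fin m → X => F (Fin.cons x T) ^ 2)
          - iidSum p (fun T : Fin m → X => F (Fin.cons x T)) ^ 2)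
        ≤ ∑ i : Fin m, iidSum p fun T => (F T - R i.succ T) ^ 2 := by
      have : ∑ i : Fin m, iidSum p (fun T => (F T - R i.succ T) ^ 2)
          = ∑ x, p x * ∑ i : Fin m, iidSum p fun T : Fin m → X =>
              (F (Fin.cons x T) - R i.succ (Fin.cons x T)) ^ 2 := by
        simp only [hcons, Finset.mul_sum]
        rw [Finset.sum_comm]
      rw [this]
      refine Finset.sum_le_sum fun x _ => mul_le_mul_of_nonneg_left ?_ (hp x)
      refine ih (fun T => F (Fin.cons x T)) (fun i T => R i.succ (Fin.cons x T)) fun i T y => ?_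
      rw [Fin.cons_update, hR]
    have hhead : ∑ x, p x * iidSum p (fun T : Fin m → X => F (Fin.cons x T)) ^ 2
          - (∑ x, p x * iidSum p fun T : Fin m → X => F (Fin.cons x T)) ^ 2
        ≤ iidSum p fun T => (F T - R 0 T) ^ 2 := by
      rcases isEmpty_or_nonempty X with hX | ⟨⟨x₀⟩⟩
      · simp at hp1
      have hR0 : ∀ x (T : Fin m → X), R 0 (Fin.cons x T) = R 0 (Fin.cons x₀ T) := fun x T => by
        rw [← hR 0 (Fin.cons x₀ T) x, Fin.update_cons_zero]
      -- `R 0` ignores the first sample, so its mean over the others is a constant; a variance is at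
      -- most the second moment about any constant, and Jensen moves the square inside.
      refine (variance_le_of_const hp1 _
        (iidSum p fun T : Fin m → X => R 0 (Fin.cons x₀ T))).trans ?_
      rw [hcons]
      refine Finset.sum_le_sum fun x _ => mul_le_mul_of_nonneg_left ?_ (hp x)
      refine le_trans (le_of_eq ?_) (sq_iidSum_le hp hp1 _)
      congr 1
      simp only [hR0 x, sub_eq_add_neg, iidSum_add]
      congr 1
      have := iidSum_const_mul p (-1) fun T : Fin m → X => R 0 (Fin.cons x₀ T)
      simpa using this.symm
    rw [hcons, hcons F]
    simp only [mul_sub, Finset.sum_sub_distrib] at htail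
    linarith

/-- Efron–Stein for a statistic `F` of the whole sample and a statistic `R` of one sample less. -/
theorem efron_stein_removeNth {p : X → ℝ} (hp : ∀ x, 0 ≤ p x) (hp1 : ∑ x, p x = 1) {m : ℕ}
    (F : (Fin (m + 1) → X) → ℝ) (R : (Fin m → X) → ℝ) (C : ℝ)
    (h : ∀ i : Fin (m + 1),
      ∑ x, p x * (iidSum p fun T => (F (i.insertNth x T) - R T) ^ 2) ≤ C) :
    iidSum p (fun T => F T ^ 2) - iidSum p F ^ 2 ≤ (m + 1) * C := by
  refine (efron_stein hp hp1 F (fun i T => R (i.removeNth T)) fun i T x => ?_).trans ?_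
  · simp
  · calc _ ≤ ∑ _i : Fin (m + 1), C := Finset.sum_le_sum fun i _ => ?_
      _ = (m + 1) * C := by simp
    rw [iidSum_insertNth p i]
    simpa using h i

lemma iidSum_linear {p : X → ℝ} (hp1 : ∑ x, p x = 1) (m : ℕ) (s : X → ℝ) :
    iidSum p (fun T : Fin m → X => ∑ i, s (T i)) = m * ∑ x, p x * s x := by
  induction m with
  | zero => simp [iidSum_zero]
  | succ m ih =>
    rw [iidSum_insertNth p 0]
    simp only [Fin.sum_univ_succ, Fin.insertNth_zero', Fin.cons_zero, Fin.cons_succ, iidSum_add,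
      iidSum_const hp1, ih, mul_add, Finset.sum_add_distrib, ← Finset.sum_mul, hp1]
    push_cast
    ring

lemma iidSum_linear_sq {p : X → ℝ} (hp1 : ∑ x, p x = 1) (m : ℕ) (s : X → ℝ) :
    iidSum p (fun T : Fin m → X => (∑ i, s (T i)) ^ 2)
      = m * ∑ x, p x * s x ^ 2 + m * (m - 1) * (∑ x, p x * s x) ^ 2 := by
  induction m with
  | zero => simp [iidSum_zero]
  | succ m ih =>
    rw [iidSum_insertNth p 0]
    have e : ∀ x, iidSum p (fun T : Fin m → X =>
        (∑ i, s ((0 : Fin (m + 1)).insertNth (α := fun _ => X) x T i)) ^ 2)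
        = s x ^ 2 + 2 * s x * (m * ∑ x, p x * s x)
          + (m * ∑ x, p x * s x ^ 2 + m * (m - 1) * (∑ x, p x * s x) ^ 2) := fun x => by
      rw [← ih, ← iidSum_linear hp1, ← iidSum_const_mul,
        ← iidSum_const (m := m) hp1 (s x ^ 2), ← iidSum_add, ← iidSum_add]
      congr 1
      funext T
      simp only [Fin.sum_univ_succ, Fin.insertNth_zero', Fin.cons_zero, Fin.cons_succ]
      ring
    simp only [e]
    have : ∀ x, p x * (s x ^ 2 + 2 * s x * (m * ∑ x, p x * s x)
          + (m * ∑ x, p x * s x ^ 2 + m * (m - 1) * (∑ x, p x * s x) ^ 2))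
        = p x * s x ^ 2 + (p x * s x) * (2 * (m * ∑ x, p x * s x))
          + p x * (m * ∑ x, p x * s x ^ 2 + m * (m - 1) * (∑ x, p x * s x) ^ 2) :=
      fun x => by ring
    simp only [this, Finset.sum_add_distrib, ← Finset.sum_mul, hp1]
    push_cast
    ring

end IidSum

/-! ### Hyperbolic estimates and the increments of `d * tanh (t * d)`. -/

section Tanh

lemma hasDerivAt_tanh (x : ℝ) : HasDerivAt Real.tanh (1 - Real.tanh x ^ 2) x := by
  have h := (Real.hasDerivAt_sinh x).div (Real.hasDerivAt_cosh x) (Real.cosh_pos x).ne'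
  have e : (Real.sinh / Real.cosh) = Real.tanh := by
    funext y; simp [Real.tanh_eq_sinh_div_cosh]
  rw [e] at h
  refine h.congr_deriv ?_
  have := (Real.cosh_pos x).ne'
  rw [Real.tanh_eq_sinh_div_cosh]
  field_simp

lemma tanh_monotone : Monotone Real.tanh :=
  monotone_of_deriv_nonneg (fun x => (hasDerivAt_tanh x).differentiableAt) fun x => by
    rw [(hasDerivAt_tanh x).deriv]
    linarith [Real.tanh_sq_lt_one x]

lemma tanh_nonneg {x : ℝ} (hx : 0 ≤ x) : 0 ≤ Real.tanh x := by
  simpa using tanh_monotone hx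

lemma abs_tanh_sub_le (x y : ℝ) : |Real.tanh x - Real.tanh y| ≤ |x - y| := by
  have h := Convex.norm_image_sub_le_of_norm_hasDerivWithin_le (𝕜 := ℝ) (f := Real.tanh)
    (f' := fun x => 1 - Real.tanh x ^ 2) (s := Set.univ) (C := 1) (x := y) (y := x)
    (fun z _ => (hasDerivAt_tanh z).hasDerivWithinAt) (fun z _ => by
      rw [Real.norm_eq_abs, abs_le]
      constructor <;> nlinarith [Real.tanh_sq_lt_one z, sq_nonneg (Real.tanh z)])
    convex_univ trivial trivial
  simpa using h

lemma abs_tanh_le (x : ℝ) : |Real.tanh x| ≤ |x| := by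
  simpa using abs_tanh_sub_le x 0

lemma one_sub_tanh_le (x : ℝ) : 1 - Real.tanh x ≤ 2 * Real.exp (-(2 * x)) := by
  have e : 1 - Real.tanh x = 2 * Real.exp (-x) / (Real.exp x + Real.exp (-x)) := by
    rw [Real.tanh_eq]
    have : Real.exp x + Real.exp (-x) ≠ 0 := by positivity
    field_simp
    ring
  rw [e, div_le_iff₀ (by positivity)]
  have h1 : Real.exp (-(2 * x)) * Real.exp x = Real.exp (-x) := by
    rw [← Real.exp_add]; congr 1; ring
  have h2 : 0 ≤ Real.exp (-(2 * x)) * Real.exp (-x) := by positivity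
  nlinarith

lemma one_sub_tanh_eq (t : ℝ) :
    1 - Real.tanh t = (1 + Real.tanh t) * Real.exp (-(2 * t)) := by
  have h1 : Real.exp t * Real.exp (-(2 * t)) = Real.exp (-t) := by
    rw [← Real.exp_add]; congr 1; ring
  have h2 : 1 - Real.tanh t = 2 * Real.exp (-t) / (Real.exp t + Real.exp (-t)) := by
    rw [Real.tanh_eq]
    have : Real.exp t + Real.exp (-t) ≠ 0 := by positivity
    field_simp
    ring
  have h3 : 1 + Real.tanh t = 2 * Real.exp t / (Real.exp t + Real.exp (-t)) := by
    rw [Real.tanh_eq]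
    have : Real.exp t + Real.exp (-t) ≠ 0 := by positivity
    field_simp
    ring
  rw [h2, h3, ← h1]
  ring

lemma nat_mul_sinh_le {t : ℝ} (ht : 0 ≤ t) (n : ℕ) : n * Real.sinh t ≤ Real.sinh (n * t) := by
  induction n with
  | zero => simp
  | succ n ih =>
    have h1 : 0 ≤ Real.sinh (n * t) := Real.sinh_nonneg_iff.2 (by positivity)
    have h2 : 0 ≤ Real.sinh t := Real.sinh_nonneg_iff.2 ht
    have e : ((n + 1 : ℕ) : ℝ) * t = n * t + t := by push_cast; ring
    rw [e, Real.sinh_add]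
    push_cast
    nlinarith [Real.one_le_cosh t, Real.one_le_cosh (n * t)]

lemma int_abs_mul_sinh_le {t : ℝ} (ht : 0 ≤ t) (d : ℤ) :
    |(d : ℝ)| * Real.sinh t ≤ Real.cosh (t * d) := by
  have h := nat_mul_sinh_le ht d.natAbs
  have e : ((d.natAbs : ℕ) : ℝ) = |(d : ℝ)| := by
    rw [← Int.cast_abs, Int.abs_eq_natAbs]; rfl
  rw [e] at h
  have h2 : Real.cosh (t * d) = Real.cosh (|(d : ℝ)| * t) := by
    rw [← Real.cosh_abs, abs_mul, abs_of_nonneg ht, mul_comm]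
  rw [h2]
  exact h.trans (Real.sinh_lt_cosh _).le

/-- The difference of the two `tanh` is `± sinh t` over a product of `cosh`, and `cosh (t * d)`
alone absorbs `|d| * sinh t`. This keeps increments of `tilt` bounded however large the imbalance
is. -/
lemma int_abs_mul_tanh_sub_le {t : ℝ} (ht : 0 ≤ t) (d : ℤ) {s : ℝ} (hs : s = 1 ∨ s = -1) :
    |(d : ℝ) * (Real.tanh (t * (d + s)) - Real.tanh (t * d))| ≤ 1 := by
  have hc1 := Real.cosh_pos (t * (d + s))
  have hc2 := Real.cosh_pos (t * d)
  have e : Real.tanh (t * (d + s)) - Real.tanh (t * d)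
      = Real.sinh (t * s) / (Real.cosh (t * (d + s)) * Real.cosh (t * d)) := by
    have : t * s = t * (d + s) - t * d := by ring
    rw [this, Real.sinh_sub, Real.tanh_eq_sinh_div_cosh, Real.tanh_eq_sinh_div_cosh]
    field_simp
  have hsinh : |Real.sinh (t * s)| = Real.sinh t := by
    have := abs_of_nonneg (Real.sinh_nonneg_iff.2 ht)
    rcases hs with rfl | rfl <;> simp [this]
  rw [e, abs_mul, abs_div, hsinh, abs_of_pos (mul_pos hc1 hc2), mul_div_assoc', div_le_one
    (mul_pos hc1 hc2)]
  nlinarith [int_abs_mul_sinh_le ht d, Real.one_le_cosh (t * (d + s))]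

/-- The posterior mean of `s * d`, for a sign `s` observed through `d` with log odds `2 t d`. -/
noncomputable def tilt (t : ℝ) (d : ℤ) : ℝ := d * Real.tanh (t * d)

/-- Subtracting `tanh t`, which the drift supplies, makes the increment vanish at `d = 0`: a sample
matters only if its pair is already unbalanced. The first bound serves large `m / N`, the second
small `m / N`. -/
lemma abs_tilt_increment_le {t : ℝ} (ht : 0 ≤ t) (d : ℤ) {s : ℤ} (hs : s = 1 ∨ s = -1) :
    |tilt t (s + d) - tilt t d - Real.tanh t| ≤ 3 ∧
      |tilt t (s + d) - tilt t d - Real.tanh t| ≤ 4 * min t 1 * |(d : ℝ)| := by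
  have hs' : (s : ℝ) = 1 ∨ (s : ℝ) = -1 := by
    rcases hs with rfl | rfl <;> simp
  have hsabs : |(s : ℝ)| = 1 := by rcases hs' with h | h <;> simp [h]
  have e : tilt t (s + d) - tilt t d - Real.tanh t
      = s * Real.tanh (t * (d + s)) - Real.tanh t
        + d * (Real.tanh (t * (d + s)) - Real.tanh (t * d)) := by
    unfold tilt
    push_cast
    rw [add_comm (s : ℝ) d]
    ring
  have b1 : |s * Real.tanh (t * (d + s))| ≤ 1 := by
    rw [abs_mul, hsabs, one_mul]
    exact (Real.abs_tanh_lt_one _).le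
  have b2 : |Real.tanh t| ≤ 1 := (Real.abs_tanh_lt_one _).le
  have b3 := int_abs_mul_tanh_sub_le ht d hs'
  have h3 : |tilt t (s + d) - tilt t d - Real.tanh t| ≤ 3 := by
    rw [e]
    refine (abs_add_le _ _).trans ?_
    linarith [abs_sub (s * Real.tanh (t * (d + s))) (Real.tanh t)]
  refine ⟨h3, ?_⟩
  rcases eq_or_ne d 0 with rfl | hd
  · have : tilt t (s + 0) - tilt t 0 - Real.tanh t = 0 := by
      unfold tilt
      rcases hs with rfl | rfl <;> simp
    rw [this]
    simp
  have hd1 : (1 : ℝ) ≤ |(d : ℝ)| := by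
    rw [← Int.cast_abs]
    exact_mod_cast Int.one_le_abs hd
  rcases le_total t 1 with h | h
  · rw [min_eq_left h, e]
    have c1 : |s * Real.tanh (t * (d + s))| ≤ t * (|(d : ℝ)| + 1) := by
      rw [abs_mul, hsabs, one_mul]
      refine (abs_tanh_le _).trans ?_
      rw [abs_mul, abs_of_nonneg ht]
      refine mul_le_mul_of_nonneg_left ?_ ht
      simpa [hsabs] using abs_add_le (d : ℝ) s
    have c2 : |Real.tanh t| ≤ t := (abs_tanh_le t).trans_eq (abs_of_nonneg ht)
    have c3 : |d * (Real.tanh (t * (d + s)) - Real.tanh (t * d))| ≤ |(d : ℝ)| * t := by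
      rw [abs_mul]
      refine mul_le_mul_of_nonneg_left ((abs_tanh_sub_le _ _).trans_eq ?_) (abs_nonneg _)
      rw [← mul_sub, add_sub_cancel_left, abs_mul, hsabs, abs_of_nonneg ht, mul_one]
    refine (abs_add_le _ _).trans ?_
    nlinarith [abs_sub (s * Real.tanh (t * (d + s))) (Real.tanh t)]
  · rw [min_eq_right h]
    linarith

end Tanh

/-! ### The paired hard family and its flip-invariant score. -/

section Cells

/-- `[n]` for `n = 2 N + e`: `N` pairs of elements and `e` leftover elements. -/
abbrev Cell (N e : ℕ) := (Fin N × Bool) ⊕ Fin e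

/-- The sign of an element of a pair. -/
def signOf (b : Bool) : ℤ := bif b then 1 else -1

lemma signOf_eq (b : Bool) : signOf b = 1 ∨ signOf b = -1 := by cases b <;> simp [signOf]

lemma signOf_not (b : Bool) : signOf (!b) = -signOf b := by cases b <;> simp [signOf]

variable {N e : ℕ}

/-- The hard distribution with bias `ξ`: uniform for `ξ = 0`, and uniform on one element of each
pair for `ξ = 1`. -/
noncomputable def cellWeight (ξ : ℝ) : Cell N e → ℝ
  | .inl (_, b) => (1 + signOf b * ξ) * (1 + e * ξ ^ 2 / (2 * N)) / (2 * N + e)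
  | .inr _ => (1 - ξ ^ 2) / (2 * N + e)

/-- Swapping the two elements of the pair `j`. -/
def flip (j : Fin N) : Equiv.Perm (Cell N e) :=
  Function.Involutive.toPerm
    (fun x => match x with
      | .inl (k, b) => .inl (k, if k = j then !b else b)
      | .inr i => .inr i)
    (by
      rintro (⟨k, b⟩ | i)
      · by_cases h : k = j <;> simp [h]
      · rfl)

/-- The sign of an element with respect to the pair `j`, zero outside of this pair. -/
def charge (j : Fin N) : Cell N e → ℤ
  | .inl (k, b) => if k = j then signOf b else 0
  | .inr _ => 0

lemma charge_flip (j : Fin N) (x : Cell N e) : charge j (flip j x) = -charge j x := by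
  rcases x with ⟨k, b⟩ | i
  · by_cases h : k = j <;> simp [charge, flip, Function.Involutive.toPerm, h, signOf_not]
  · simp [charge, flip, Function.Involutive.toPerm]

lemma cellWeight_nonneg {ξ : ℝ} (h0 : 0 ≤ ξ) (h1 : ξ ≤ 1) (x : Cell N e) :
    0 ≤ cellWeight ξ x := by
  rcases x with ⟨k, b⟩ | i
  · have : (0 : ℝ) ≤ 1 + signOf b * ξ := by
      rcases signOf_eq b with h | h <;> rw [h] <;> push_cast <;> linarith
    simp only [cellWeight]
    positivity
  · have : (0 : ℝ) ≤ 1 - ξ ^ 2 := by nlinarith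
    simp only [cellWeight]
    positivity

lemma sum_cell (f : Cell N e → ℝ) :
    ∑ x, f x = ∑ k, (f (.inl (k, true)) + f (.inl (k, false))) + ∑ i, f (.inr i) := by
  rw [Fintype.sum_sum_type, Fintype.sum_prod_type]
  simp

/-- The leftover elements lose the fraction `ξ ^ 2` of their mass and the second factor in the pair
weights returns it. At `ξ = 1` they are empty, so the distance to uniform reaches `1 / 2` for odd
`n` too. -/
lemma sum_cellWeight (hN : 1 ≤ N) (ξ : ℝ) : ∑ x : Cell N e, cellWeight ξ x = 1 := by
  have hN' : (0 : ℝ) < N := by exact_mod_cast hN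
  have : (2 * N + e : ℝ) ≠ 0 := by positivity
  rw [sum_cell]
  simp only [cellWeight, signOf, cond_true, cond_false, Finset.sum_const, Finset.card_univ,
    Fintype.card_fin, nsmul_eq_mul]
  push_cast
  field_simp
  ring

lemma cellWeight_flip (t : ℝ) (j : Fin N) (x : Cell N e) :
    cellWeight (Real.tanh t) (flip j x)
      = cellWeight (Real.tanh t) x * Real.exp (-(2 * t * charge j x)) := by
  rcases x with ⟨k, b⟩ | i
  · by_cases h : k = j
    · have h1 := one_sub_tanh_eq t
      have h2 : Real.exp (-(2 * t)) * Real.exp (2 * t) = 1 := by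
        rw [← Real.exp_add]; simp
      cases b <;>
        simp [cellWeight, charge, flip, Function.Involutive.toPerm, h, signOf, ← sub_eq_add_neg,
          h1]
      · linear_combination (-((1 + Real.tanh t)
          * ((1 + e * (Real.tanh t ^ 2 / (2 * N))) / (2 * N + e)))) * h2
      · ring
    · simp [cellWeight, charge, flip, Function.Involutive.toPerm, h]
  · simp [cellWeight, charge, flip, Function.Involutive.toPerm]

/-- The part of the score in the direction of `t`, for `ξ = tanh t`, that does not depend on the
sign. -/
noncomputable def drift (t : ℝ) : Cell N e → ℝ
  | .inl _ => -Real.tanh t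
      + 2 * e * Real.tanh t * (1 - Real.tanh t ^ 2) / (2 * N + e * Real.tanh t ^ 2)
  | .inr _ => -2 * Real.tanh t

/-- With `ξ = tanh t`, the logarithmic derivative of `1 + σ ξ` for a sign `σ` is `σ - tanh t`. The
score is thus the sign plus a flip-invariant term, even as `ξ` approaches `1`. -/
lemma hasDerivAt_cellWeight (hN : 1 ≤ N) (t : ℝ) (x : Cell N e) :
    HasDerivAt (fun t => cellWeight (Real.tanh t) x)
      (cellWeight (Real.tanh t) x * (∑ j, (charge j x : ℝ) + drift t x)) t := by
  have hN' : (0 : ℝ) < N := by exact_mod_cast hN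
  have ht := hasDerivAt_tanh t
  have hsq := ht.pow 2
  rcases x with ⟨k, b⟩ | i
  · have h := (((ht.const_mul (signOf b : ℝ)).const_add 1).mul
      (((hsq.const_mul (e : ℝ)).div_const (2 * N)).const_add 1)).div_const (2 * N + e)
    refine h.congr_deriv ?_
    have hs : (signOf b : ℝ) ^ 2 = 1 := by rcases signOf_eq b with h | h <;> rw [h] <;> norm_num
    have hden : 2 * (N : ℝ) + e * Real.tanh t ^ 2 ≠ 0 := by positivity
    simp only [cellWeight, drift, charge, Pi.pow_apply]
    simp only [Int.cast_ite, Int.cast_zero, Finset.sum_ite_eq, Finset.mem_univ, if_true]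
    field_simp
    push_cast
    linear_combination (-(Real.tanh t) * (2 * N + e * Real.tanh t ^ 2)) * hs
  · have h := (hsq.const_sub 1).div_const (2 * N + e : ℝ)
    refine h.congr_deriv ?_
    simp only [cellWeight, drift, charge]
    push_cast
    simp
    ring

/-- The sum of the signs of the samples in the pair `j`. -/
def imbalance {m : ℕ} (j : Fin N) (T : Fin m → Cell N e) : ℤ := ∑ i, charge j (T i)

/-- The score of the unordered model in the direction of `t`. -/
noncomputable def statistic (t : ℝ) {m : ℕ} (T : Fin m → Cell N e) : ℝ :=
  ∑ j, tilt t (imbalance j T) + ∑ i, drift t (T i)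

/-- Change of variables; the exponential is the likelihood ratio between a flipped sample and the
original. -/
lemma iidSum_flip (t : ℝ) {m : ℕ} (j : Fin N) (F : (Fin m → Cell N e) → ℝ) :
    iidSum (cellWeight (Real.tanh t)) F
      = iidSum (cellWeight (Real.tanh t)) fun T =>
          Real.exp (-(2 * t * imbalance j T)) * F fun i => flip j (T i) := by
  unfold iidSum
  rw [← (Equiv.arrowCongr (Equiv.refl (Fin m)) (flip j)).sum_comp]
  refine Finset.sum_congr rfl fun T _ => ?_
  have : Real.exp (-(2 * t * imbalance j T))
      = ∏ i, Real.exp (-(2 * t * charge j (T i))) := by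
    rw [← Real.exp_sum]
    congr 1
    simp [imbalance, Finset.mul_sum]
  have hT : (Equiv.arrowCongr (Equiv.refl (Fin m)) (flip j)) T = fun i => flip j (T i) := rfl
  simp only [hT, cellWeight_flip, Finset.prod_mul_distrib, this]
  ring

lemma tilt_mul_exp (t : ℝ) (d : ℤ) :
    tilt t d * (1 + Real.exp (-(2 * t * d))) = d * (1 - Real.exp (-(2 * t * d))) := by
  have h := one_sub_tanh_eq (t * d)
  rw [← mul_assoc] at h
  unfold tilt
  linear_combination (-(d : ℝ)) * h

/-- Conditional expectation over the flip of one pair: `d` and `-d` carry relative weights `1` and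
`exp (-2 t d)`, so their mean is `d * tanh (t * d)`. -/
lemma iidSum_imbalance (t : ℝ) {m : ℕ} (j : Fin N) (a : (Fin m → Cell N e) → ℝ)
    (ha : ∀ T, a (fun i => flip j (T i)) = a T) :
    iidSum (cellWeight (Real.tanh t)) (fun T => (imbalance j T : ℝ) * a T)
      = iidSum (cellWeight (Real.tanh t)) fun T => tilt t (imbalance j T) * a T := by
  have himb : ∀ T : Fin m → Cell N e, imbalance j (fun i => flip j (T i)) = -imbalance j T := by
    intro T
    simp [imbalance, charge_flip]
  have htilt : ∀ d : ℤ, tilt t (-d) = tilt t d := fun d => by simp [tilt]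
  have h1 := iidSum_flip t j fun T => (imbalance j T : ℝ) * a T
  have h2 := iidSum_flip t j fun T => tilt t (imbalance j T) * a T
  simp only [himb, ha, htilt] at h1 h2
  have h3 : iidSum (cellWeight (Real.tanh t)) (fun T : Fin m → Cell N e =>
        (imbalance j T : ℝ) * a T
          + Real.exp (-(2 * t * imbalance j T)) * (((-imbalance j T : ℤ) : ℝ) * a T))
      = iidSum (cellWeight (Real.tanh t)) (fun T : Fin m → Cell N e =>
        tilt t (imbalance j T) * a T
          + Real.exp (-(2 * t * imbalance j T)) * (tilt t (imbalance j T) * a T)) := by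
    congr 1
    funext T
    push_cast
    linear_combination (-a T) * tilt_mul_exp t (imbalance j T)
  rw [iidSum_add, iidSum_add, ← h1, ← h2] at h3
  linarith

lemma hasDerivAt_iidSum (hN : 1 ≤ N) (t : ℝ) {m : ℕ} (a : (Fin m → Cell N e) → ℝ)
    (ha : ∀ j T, a (fun i => flip j (T i)) = a T) :
    HasDerivAt (fun t => iidSum (cellWeight (Real.tanh t)) a)
      (iidSum (cellWeight (Real.tanh t)) fun T => statistic t T * a T) t := by
  have h : HasDerivAt (fun t => iidSum (cellWeight (Real.tanh t)) a)
      (iidSum (cellWeight (Real.tanh t)) fun T =>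
        (∑ i, (∑ j, (charge j (T i) : ℝ) + drift t (T i))) * a T) t := by
    unfold iidSum
    refine HasDerivAt.fun_sum fun T _ => ?_
    refine ((HasDerivAt.fun_finsetProd fun i _ =>
      hasDerivAt_cellWeight hN t (T i)).mul_const (a T)).congr_deriv ?_
    beta_reduce
    rw [Finset.sum_mul, Finset.sum_mul, Finset.mul_sum]
    refine Finset.sum_congr rfl fun i _ => ?_
    rw [← Finset.mul_prod_erase _ _ (Finset.mem_univ i), smul_eq_mul]
    ring
  refine h.congr_deriv ?_
  have e1 : ∀ T : Fin m → Cell N e, (∑ i, (∑ j, (charge j (T i) : ℝ) + drift t (T i))) * a T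
      = ∑ j, (imbalance j T : ℝ) * a T + (∑ i, drift t (T i)) * a T := fun T => by
    rw [Finset.sum_add_distrib, Finset.sum_comm, add_mul, Finset.sum_mul]
    simp [imbalance]
  have e2 : ∀ T : Fin m → Cell N e, statistic t T * a T
      = ∑ j, tilt t (imbalance j T) * a T + (∑ i, drift t (T i)) * a T := fun T => by
    rw [statistic, add_mul, Finset.sum_mul]
  simp only [e1, e2, iidSum_add, iidSum_sum]
  congr 1
  exact Finset.sum_congr rfl fun j _ => iidSum_imbalance t j a (ha j)

/-- Scores have mean zero because total mass is constant in `t`; hence Efron–Stein bounds the second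
moment itself. -/
lemma iidSum_statistic (hN : 1 ≤ N) (t : ℝ) (m : ℕ) :
    iidSum (cellWeight (Real.tanh t)) (fun T : Fin m → Cell N e => statistic t T) = 0 := by
  have h := hasDerivAt_iidSum hN t (fun _ : Fin m → Cell N e => 1) fun _ _ => rfl
  simp only [iidSum_const (sum_cellWeight hN _), mul_one] at h
  exact h.unique (hasDerivAt_const t 1)

end Cells

/-! ### Second moment of the projected score. -/

section Variance

variable {N e : ℕ}

lemma statistic_insertNth (t : ℝ) {m : ℕ} (i : Fin (m + 1)) (x : Cell N e)
    (T : Fin m → Cell N e) :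
    statistic t (i.insertNth (α := fun _ => Cell N e) x T) - statistic t T
      = ∑ j, (tilt t (charge j x + imbalance j T) - tilt t (imbalance j T)) + drift t x := by
  have h : ∀ j, imbalance j (i.insertNth (α := fun _ => Cell N e) x T)
      = charge j x + imbalance j T := fun j => by
    simp [imbalance, Fin.sum_univ_succAbove _ i]
  simp only [statistic, h, Fin.sum_univ_succAbove _ i, Fin.insertNth_apply_same,
    Fin.insertNth_apply_succAbove, Finset.sum_sub_distrib]
  ring

lemma sum_tilt_pair (t : ℝ) {m : ℕ} (k : Fin N) (b : Bool) (T : Fin m → Cell N e) :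
    ∑ j, (tilt t (charge j (.inl (k, b) : Cell N e) + imbalance j T) - tilt t (imbalance j T))
      = tilt t (signOf b + imbalance k T) - tilt t (imbalance k T) := by
  rw [Finset.sum_eq_single k]
  · simp [charge]
  · intro j _ hj
    simp [charge, hj.symm]
  · simp

lemma statistic_increment_sq_le (hN : 1 ≤ N) (he : e ≤ 1) {t : ℝ} (ht : 0 ≤ t) {m : ℕ}
    (i : Fin (m + 1)) (k : Fin N) (b : Bool) (T : Fin m → Cell N e) :
    (statistic t (i.insertNth (α := fun _ => Cell N e) (.inl (k, b)) T) - statistic t T) ^ 2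
        ≤ 20 ∧
      (statistic t (i.insertNth (α := fun _ => Cell N e) (.inl (k, b)) T) - statistic t T) ^ 2
        ≤ 32 * min t 1 ^ 2 * (imbalance k T : ℝ) ^ 2 + 2 * (min t 1 / N) ^ 2 := by
  have hN' : (1 : ℝ) ≤ N := by exact_mod_cast hN
  have he' : (e : ℝ) ≤ 1 := by exact_mod_cast he
  have hx0 := tanh_nonneg ht
  have hx1 := Real.tanh_lt_one t
  have hxt : Real.tanh t ≤ min t 1 :=
    le_min ((le_abs_self _).trans ((abs_tanh_le t).trans_eq (abs_of_nonneg ht))) hx1.le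
  obtain ⟨h3, h4⟩ := abs_tilt_increment_le ht (imbalance k T) (signOf_eq b)
  rw [statistic_insertNth, sum_tilt_pair]
  simp only [drift]
  set A := tilt t (signOf b + imbalance k T) - tilt t (imbalance k T) with hA
  set c := 2 * e * Real.tanh t * (1 - Real.tanh t ^ 2) / (2 * N + e * Real.tanh t ^ 2) with hc
  have hc0 : 0 ≤ c := by
    have : 0 ≤ 1 - Real.tanh t ^ 2 := by nlinarith
    positivity
  have hc1 : c ≤ min t 1 / N := by
    refine le_trans ?_ (div_le_div_of_nonneg_right hxt (by positivity))
    rw [hc, div_le_div_iff₀ (by positivity) (by positivity)]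
    have h1 : (e : ℝ) * Real.tanh t * (1 - Real.tanh t ^ 2) ≤ Real.tanh t := by
      calc (e : ℝ) * Real.tanh t * (1 - Real.tanh t ^ 2)
          ≤ 1 * Real.tanh t * 1 := by gcongr <;> nlinarith
        _ = Real.tanh t := by ring
    have h2 : 0 ≤ Real.tanh t * (e * Real.tanh t ^ 2) := by positivity
    nlinarith
  have hc2 : c ≤ 1 := hc1.trans (by
    rw [div_le_one (by positivity)]
    exact (min_le_right _ _).trans hN')
  have e1 : A + (-Real.tanh t + c) = (A - Real.tanh t) + c := by ring
  rw [e1]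
  have hsq : ((A - Real.tanh t) + c) ^ 2 ≤ 2 * (A - Real.tanh t) ^ 2 + 2 * c ^ 2 := by
    nlinarith [sq_nonneg ((A - Real.tanh t) - c)]
  have q3 : (A - Real.tanh t) ^ 2 ≤ 9 := by
    rw [← sq_abs]; nlinarith [abs_nonneg (A - Real.tanh t)]
  have q4 : (A - Real.tanh t) ^ 2 ≤ 16 * min t 1 ^ 2 * (imbalance k T : ℝ) ^ 2 := by
    have := pow_le_pow_left₀ (abs_nonneg _) h4 2
    rw [sq_abs] at this
    refine this.trans_eq ?_
    rw [mul_pow, mul_pow, sq_abs]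
    ring
  have qc : c ^ 2 ≤ (min t 1 / N) ^ 2 := pow_le_pow_left₀ hc0 hc1 2
  constructor <;> nlinarith

lemma cellWeight_pair_add (hN : 1 ≤ N) (he : e ≤ 1) {ξ : ℝ} (h0 : 0 ≤ ξ) (h1 : ξ ≤ 1)
    (k : Fin N) :
    cellWeight ξ (.inl (k, true) : Cell N e) + cellWeight ξ (.inl (k, false) : Cell N e)
      ≤ 1 / N := by
  have hN' : (1 : ℝ) ≤ N := by exact_mod_cast hN
  have he' : (e : ℝ) ≤ 1 := by exact_mod_cast he
  have e1 : cellWeight ξ (.inl (k, true) : Cell N e) + cellWeight ξ (.inl (k, false) : Cell N e)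
      = (2 * N + e * ξ ^ 2) / (N * (2 * N + e)) := by
    simp only [cellWeight, signOf, cond_true, cond_false]
    push_cast
    field_simp
    ring
  rw [e1, div_le_div_iff₀ (by positivity) (by positivity)]
  have : (e : ℝ) * ξ ^ 2 ≤ e := mul_le_of_le_one_right (by positivity) (by nlinarith)
  nlinarith

lemma iidSum_imbalance_sq_le (hN : 1 ≤ N) (he : e ≤ 1) {ξ : ℝ} (h0 : 0 ≤ ξ) (h1 : ξ ≤ 1) (m : ℕ)
    (k : Fin N) :
    iidSum (cellWeight ξ) (fun T : Fin m → Cell N e => (imbalance k T : ℝ) ^ 2)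
      ≤ m / N + (m / N * ξ) ^ 2 := by
  have hN' : (1 : ℝ) ≤ N := by exact_mod_cast hN
  have h := iidSum_linear_sq (sum_cellWeight (e := e) hN ξ) m fun x => (charge k x : ℝ)
  have e0 : ∀ T : Fin m → Cell N e, (imbalance k T : ℝ) = ∑ i, (charge k (T i) : ℝ) := fun T => by
    simp [imbalance]
  have hP := cellWeight_pair_add hN he h0 h1 k
  set P := cellWeight ξ (.inl (k, true) : Cell N e) + cellWeight ξ (.inl (k, false) : Cell N e)
    with hPdef
  have hP0 : 0 ≤ P := add_nonneg (cellWeight_nonneg h0 h1 _) (cellWeight_nonneg h0 h1 _)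
  have e1 : ∑ x : Cell N e, cellWeight ξ x * (charge k x : ℝ) ^ 2 = P := by
    rw [sum_cell, Finset.sum_eq_single k]
    · simp [charge, signOf, hPdef]
    · intro j _ hj; simp [charge, hj]
    · simp
  have e2 : ∑ x : Cell N e, cellWeight ξ x * (charge k x : ℝ) = P * ξ := by
    rw [sum_cell, Finset.sum_eq_single k]
    · simp only [charge, signOf, hPdef, cellWeight]
      push_cast
      simp
      ring
    · intro j _ hj; simp [charge, hj]
    · simp
  simp only [e0]
  rw [h, e1, e2]
  have hm : (0 : ℝ) ≤ m := by positivity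
  have i1 : m * P ≤ m / N := by
    rw [div_eq_mul_one_div]; exact mul_le_mul_of_nonneg_left hP hm
  have i2 : (m * P * ξ) ^ 2 ≤ (m / N * ξ) ^ 2 := by gcongr
  nlinarith [mul_nonneg hm (sq_nonneg (P * ξ))]

/-- Efron–Stein against the same statistic with one sample removed. Put `u = min(t,1)^2 * m / N`.
For `u ≥ 1` the uniform increment bound suffices; for `u ≤ 1` the second moment of the imbalance
gives at most `32 (u + u^2) + 2 u ≤ 66 u` from pairs, and leftovers add `4 u`. -/
lemma iidSum_statistic_sq_le (hN : 1 ≤ N) (he : e ≤ 1) {t : ℝ} (ht : 0 ≤ t) (m : ℕ) :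
    iidSum (cellWeight (Real.tanh t)) (fun T : Fin m → Cell N e => statistic t T ^ 2)
      ≤ m * (72 * min 1 (min t 1 ^ 2 * (m / N))) := by
  have hN' : (1 : ℝ) ≤ N := by exact_mod_cast hN
  have he' : (e : ℝ) ≤ 1 := by exact_mod_cast he
  have hx0 := tanh_nonneg ht
  have hx1 := (Real.tanh_lt_one t).le
  have hxt : Real.tanh t ≤ min t 1 :=
    le_min ((le_abs_self _).trans ((abs_tanh_le t).trans_eq (abs_of_nonneg ht))) hx1
  have hw := cellWeight_nonneg (N := N) (e := e) hx0 hx1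
  have hw1 := sum_cellWeight (e := e) hN (Real.tanh t)
  set τ := min t 1 with hτ
  have hτ0 : 0 ≤ τ := le_min ht zero_le_one
  have hτ1 : τ ≤ 1 := min_le_right _ _
  rcases m with _ | m
  · have := iidSum_statistic (e := e) hN t 0
    rw [iidSum_zero] at this ⊢
    simp [this]
  set u := τ ^ 2 * ((m + 1 : ℕ) / N) with hu
  have hu0 : 0 ≤ u := by positivity
  have key := efron_stein_removeNth hw hw1 (m := m) (fun T => statistic t T)
    (fun T => statistic t T) (72 * min 1 u) fun i => by
      have hinr : ∀ (l : Fin e) (T : Fin m → Cell N e),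
          (statistic t (i.insertNth (α := fun _ => Cell N e) (.inr l) T) - statistic t T) ^ 2
            ≤ 4 * τ ^ 2 := fun l T => by
        rw [statistic_insertNth]
        simp only [charge, zero_add, sub_self, Finset.sum_const_zero, drift]
        nlinarith
      rcases le_total 1 u with h | h
      · rw [min_eq_left h, mul_one]
        calc _ ≤ ∑ x, cellWeight (Real.tanh t) x * (20 : ℝ) := by
                refine Finset.sum_le_sum fun x _ => mul_le_mul_of_nonneg_left ?_ (hw x)
                rw [← iidSum_const hw1 (m := m) (20 : ℝ)]
                refine iidSum_mono hw fun T => ?_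
                rcases x with ⟨k, b⟩ | l
                · exact (statistic_increment_sq_le hN he ht i k b T).1
                · exact (hinr l T).trans (by nlinarith)
          _ ≤ 72 := by rw [← Finset.sum_mul, hw1]; norm_num
      · rw [min_eq_right h]
        have hpair : ∀ (k : Fin N) (b : Bool),
            iidSum (cellWeight (Real.tanh t)) (fun T : Fin m → Cell N e =>
              (statistic t (i.insertNth (α := fun _ => Cell N e) (.inl (k, b)) T)
                - statistic t T) ^ 2) ≤ 66 * u := fun k b => by
          refine (iidSum_mono hw fun T => (statistic_increment_sq_le hN he ht i k b T).2).trans ?_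
          rw [iidSum_add, iidSum_const_mul, iidSum_const hw1]
          have h2 := iidSum_imbalance_sq_le (e := e) hN he hx0 hx1 m k
          have hm : (m / N : ℝ) ≤ (m + 1 : ℕ) / N := by push_cast; gcongr; linarith
          have h3 : (m / N * Real.tanh t : ℝ) ^ 2 ≤ ((m + 1 : ℕ) / N * τ) ^ 2 := by gcongr
          have h4 : (m / N * Real.tanh t : ℝ) ^ 2 * τ ^ 2 ≤ u ^ 2 := by
            refine (mul_le_mul_of_nonneg_right h3 (sq_nonneg τ)).trans_eq ?_
            rw [hu]; ring
          have h5 : (m / N : ℝ) * τ ^ 2 ≤ u := by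
            refine (mul_le_mul_of_nonneg_right hm (sq_nonneg τ)).trans_eq ?_
            rw [hu]; ring
          have h6 : (τ / N) ^ 2 ≤ u := by
            rw [div_pow, div_eq_mul_one_div, hu]
            refine mul_le_mul_of_nonneg_left ?_ (sq_nonneg τ)
            rw [div_le_div_iff₀ (by positivity) (by positivity)]
            push_cast
            nlinarith [mul_nonneg (Nat.cast_nonneg (α := ℝ) m) (sq_nonneg (N : ℝ))]
          have h7 := mul_le_mul_of_nonneg_left h2 (by positivity : (0 : ℝ) ≤ 32 * τ ^ 2)
          nlinarith
        rw [sum_cell]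
        have hA : ∑ k : Fin N, (cellWeight (Real.tanh t) (.inl (k, true) : Cell N e)
              + cellWeight (Real.tanh t) (.inl (k, false) : Cell N e)) ≤ 1 := by
          rw [← hw1, sum_cell]
          exact le_add_of_nonneg_right (Finset.sum_nonneg fun l _ => hw _)
        have hB : ∑ l : Fin e, cellWeight (Real.tanh t) (.inr l : Cell N e) ≤ 1 / N := by
          simp only [cellWeight, Finset.sum_const, Finset.card_univ, Fintype.card_fin,
            nsmul_eq_mul, mul_div_assoc']
          rw [div_le_div_iff₀ (by positivity) (by positivity)]
          have : (e : ℝ) * (1 - Real.tanh t ^ 2) ≤ 1 := by nlinarith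
          nlinarith
        have hC : (1 / N : ℝ) * (4 * τ ^ 2) ≤ 4 * u := by
          have : (1 / N : ℝ) ≤ (m + 1 : ℕ) / N := by
            gcongr; push_cast; linarith [Nat.cast_nonneg (α := ℝ) m]
          rw [hu]
          nlinarith [mul_le_mul_of_nonneg_right this (sq_nonneg τ)]
        refine (add_le_add (b := 1 * (66 * u)) (d := (1 / N) * (4 * τ ^ 2)) ?_ ?_).trans
          (by linarith)
        · refine le_trans ?_ (mul_le_mul_of_nonneg_right hA (by positivity))
          rw [Finset.sum_mul]
          refine Finset.sum_le_sum fun k _ => ?_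
          rw [add_mul]
          exact add_le_add (mul_le_mul_of_nonneg_left (hpair k true) (hw _))
            (mul_le_mul_of_nonneg_left (hpair k false) (hw _))
        · refine le_trans ?_ (mul_le_mul_of_nonneg_right hB (by positivity))
          rw [Finset.sum_mul]
          refine Finset.sum_le_sum fun l _ => mul_le_mul_of_nonneg_left ?_ (hw _)
          rw [← iidSum_const hw1 (m := m) (4 * τ ^ 2)]
          exact iidSum_mono hw (hinr l)
  rw [iidSum_statistic hN] at key
  simpa using key

/-- The acceptance probability of a flip-invariant test varies slowly along the hard family. -/
theorem sq_iidSum_statistic_mul_le (hN : 1 ≤ N) (he : e ≤ 1) {t : ℝ} (ht : 0 ≤ t) {m : ℕ}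
    (a : (Fin m → Cell N e) → ℝ) (ha : ∀ T, a T ^ 2 ≤ 1) :
    iidSum (cellWeight (Real.tanh t)) (fun T => statistic t T * a T) ^ 2
      ≤ m * (72 * min 1 (min t 1 ^ 2 * (m / N))) := by
  have hw := cellWeight_nonneg (N := N) (e := e) (tanh_nonneg ht) (Real.tanh_lt_one t).le
  refine (sq_iidSum_le hw (sum_cellWeight hN _) _).trans
    ((iidSum_mono hw fun T => ?_).trans (iidSum_statistic_sq_le hN he ht m))
  rw [mul_pow]
  exact mul_le_of_le_one_right (sq_nonneg _) (ha T)

end Variance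

/-! ### From Lipschitz acceptance probabilities to a bound on the gap. -/

section Replicability

/-- A family of acceptance probabilities that are `B`-Lipschitz in the parameter and that are mostly
close to `0` or `1` cannot change by much on average. -/
theorem sq_le_of_replicable {α : Type*} [Fintype α] (law : α → ℝ) (hlaw : ∀ a, 0 ≤ law a)
    (hlaw1 : ∑ a, law a = 1) (f f' : α → ℝ → ℝ) {s B ρ D : ℝ} (hs : 0 ≤ s)
    (hD : 0 ≤ D)
    (hf : ∀ a, law a ≠ 0 → ∀ t ∈ Set.Icc 0 s, HasDerivAt (f a) (f' a t) t)
    (hB : ∀ a, law a ≠ 0 → ∀ t ∈ Set.Icc 0 s, |f' a t| ≤ B)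
    (h0 : ∀ a, ∀ t ∈ Set.Icc 0 s, 0 ≤ f a t) (h1 : ∀ a, ∀ t ∈ Set.Icc 0 s, f a t ≤ 1)
    (hrep : ∀ t ∈ Set.Icc 0 s, 1 - ρ ≤ ∑ a, law a * (f a t ^ 2 + (1 - f a t) ^ 2))
    (hgap : D ≤ ∑ a, law a * (f a 0 - f a s)) :
    D ^ 2 ≤ 3 * B * ρ * s := by
  have hm0 : (0 : ℝ) ∈ Set.Icc 0 s := ⟨le_rfl, hs⟩
  have hms : s ∈ Set.Icc 0 s := ⟨hs, le_rfl⟩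
  have hB0 : 0 ≤ B := by
    have : ∃ a, law a ≠ 0 := by
      by_contra! h
      simp [h] at hlaw1
    obtain ⟨a, ha⟩ := this
    exact (abs_nonneg _).trans (hB a ha 0 hm0)
  -- `G' = 6 x (1 - x)` is three times the disagreement probability `1 - x^2 - (1 - x)^2`, so
  -- replicability bounds the speed of `G (f a t)` on average. The sign `c` makes every test
  -- contribute positively to the total change.
  let G : ℝ → ℝ := fun x => 3 * x ^ 2 - 2 * x ^ 3
  let c : α → ℝ := fun a => if f a s ≤ f a 0 then 1 else -1
  have hc : ∀ a, |c a| = 1 := fun a => by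
    simp only [c]; split_ifs <;> simp
  have hderiv : ∀ t ∈ Set.Icc 0 s, HasDerivAt (fun t => ∑ a, law a * (c a * G (f a t)))
      (∑ a, law a * (c a * (6 * f a t * (1 - f a t) * f' a t))) t := fun t ht => by
    refine HasDerivAt.fun_sum fun a _ => ?_
    by_cases ha : law a = 0
    · simp only [ha, zero_mul]
      exact hasDerivAt_const t 0
    · have h := hf a ha t ht
      refine (((((h.pow 2).const_mul 3).sub ((h.pow 3).const_mul 2)).const_mul (c a)).const_mul
        (law a)).congr_deriv ?_
      push_cast
      ring
  have hmvt := norm_image_sub_le_of_norm_deriv_le_segment'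
    (f := fun t => ∑ a, law a * (c a * G (f a t))) (C := 3 * B * ρ)
    (fun t ht => (hderiv t ht).hasDerivWithinAt) (fun t ht => by
      have ht' : t ∈ Set.Icc 0 s := ⟨ht.1, ht.2.le⟩
      rw [Real.norm_eq_abs]
      calc |∑ a, law a * (c a * (6 * f a t * (1 - f a t) * f' a t))|
          ≤ ∑ a, |law a * (c a * (6 * f a t * (1 - f a t) * f' a t))| :=
            Finset.abs_sum_le_sum_abs _ _
        _ ≤ ∑ a, (3 * B) * (law a - law a * (f a t ^ 2 + (1 - f a t) ^ 2)) := by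
            refine Finset.sum_le_sum fun a _ => ?_
            by_cases ha : law a = 0
            · simp [ha]
            · have p0 := h0 a t ht'
              have p1 := h1 a t ht'
              have p2 : 0 ≤ 6 * f a t * (1 - f a t) := by nlinarith
              rw [abs_mul, abs_mul, hc, abs_mul, abs_of_nonneg (hlaw a), abs_of_nonneg p2, one_mul]
              calc law a * (6 * f a t * (1 - f a t) * |f' a t|)
                  ≤ law a * (6 * f a t * (1 - f a t) * B) := by
                    gcongr
                    · exact hlaw a
                    · exact hB a ha t ht'
                _ = _ := by ring
        _ = (3 * B) * (1 - ∑ a, law a * (f a t ^ 2 + (1 - f a t) ^ 2)) := by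
            rw [← Finset.mul_sum, Finset.sum_sub_distrib, hlaw1]
        _ ≤ 3 * B * ρ := by
            refine mul_le_mul_of_nonneg_left ?_ (by positivity)
            linarith [hrep t ht']) s hms
  have hlow : D ^ 2 ≤ ∑ a, law a * (c a * G (f a 0)) - ∑ a, law a * (c a * G (f a s)) := by
    calc D ^ 2 ≤ (∑ a, law a * (f a 0 - f a s)) ^ 2 := pow_le_pow_left₀ hD hgap 2
      _ ≤ ∑ a, law a * (f a 0 - f a s) ^ 2 := by
          have := variance_le_of_const hlaw1 (fun a => f a 0 - f a s)
            (∑ a, law a * (f a 0 - f a s))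
          have e : ∑ a, law a * (f a 0 - f a s - ∑ a, law a * (f a 0 - f a s)) ^ 2
              = ∑ a, law a * (f a 0 - f a s) ^ 2 - (∑ a, law a * (f a 0 - f a s)) ^ 2 := by
            set M := ∑ a, law a * (f a 0 - f a s) with hM
            have : ∀ a, law a * (f a 0 - f a s - M) ^ 2
                = law a * (f a 0 - f a s) ^ 2 - (law a * (f a 0 - f a s)) * (2 * M)
                  + law a * M ^ 2 := fun a => by ring
            simp only [this, Finset.sum_add_distrib, Finset.sum_sub_distrib, ← Finset.sum_mul,
              hlaw1, ← hM]
            ring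
          have h0 : 0 ≤ ∑ a, law a * (f a 0 - f a s - ∑ a, law a * (f a 0 - f a s)) ^ 2 :=
            Finset.sum_nonneg fun a _ => mul_nonneg (hlaw a) (sq_nonneg _)
          linarith
      _ ≤ ∑ a, law a * (c a * (G (f a 0) - G (f a s))) := by
          refine Finset.sum_le_sum fun a _ => mul_le_mul_of_nonneg_left ?_ (hlaw a)
          have x0 := h0 a 0 hm0
          have x1 := h1 a 0 hm0
          have y0 := h0 a s hms
          have y1 := h1 a s hms
          -- `G` is flat at `0` and `1`, so its increments dominate only the square of the gap;
          -- Jensen over the tests has already turned the mean gap into a mean square.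
          have key : ∀ x y : ℝ, 0 ≤ y → y ≤ x → x ≤ 1 → (x - y) ^ 2 ≤ G x - G y := by
            intro x y hy hyx hx
            have e : G x - G y - (x - y) ^ 2
                = (x - y) * (2 * (x * (1 - x)) + 2 * (y * (1 - y)) + 2 * (y * (1 - x))) := by
              simp only [G]; ring
            have : 0 ≤ (x - y) * (2 * (x * (1 - x)) + 2 * (y * (1 - y)) + 2 * (y * (1 - x))) := by
              have a1 : 0 ≤ x * (1 - x) := mul_nonneg (hy.trans hyx) (by linarith)
              have a2 : 0 ≤ y * (1 - y) := mul_nonneg hy (by linarith)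
              have a3 : 0 ≤ y * (1 - x) := mul_nonneg hy (by linarith)
              exact mul_nonneg (by linarith) (by linarith)
            linarith
          simp only [c]
          split_ifs with h
          · rw [one_mul]; exact key _ _ y0 h x1
          · have := key _ _ x0 (le_of_not_ge h) y1
            nlinarith
      _ = _ := by
          rw [← Finset.sum_sub_distrib]
          exact Finset.sum_congr rfl fun a _ => by ring
  rw [Real.norm_eq_abs, sub_zero] at hmvt
  linarith [neg_abs_le (∑ a, law a * (c a * G (f a s)) - ∑ a, law a * (c a * G (f a 0)))]

end Replicability

/-! ### Replacing the seed by a finite law on deterministic tests. -/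

section Seeds

variable {n m : ℕ}

/-- The probability that the seed selects the deterministic test `a`. -/
noncomputable def Tester.testLaw (A : Tester.{u} n m) (a : (Fin m → Fin n) → Bool) : ℝ :=
  A.seedLaw.real {r | A.run r = a}

/-- The acceptance indicator of a deterministic test. -/
noncomputable def acceptInd {Y : Type*} (a : Y → Bool) (T : Y) : ℝ := if a T then 1 else 0

lemma Tester.measurable_run' (A : Tester.{u} n m) : Measurable A.run :=
  measurable_pi_iff.2 A.measurable_run

lemma Tester.testLaw_nonneg (A : Tester.{u} n m) (a : (Fin m → Fin n) → Bool) :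
    0 ≤ A.testLaw a := measureReal_nonneg

/-- There are finitely many deterministic tests, so an arbitrary seed space matters only through its
pushforward under `run`. Single runs and pairs of runs are both instances. -/
lemma Tester.prod_real_eq (A : Tester.{u} n m) {Y : Type*} [Fintype Y] [MeasurableSpace Y]
    [MeasurableSingletonClass Y] (ν : Measure Y) [IsProbabilityMeasure ν]
    (P : ((Fin m → Fin n) → Bool) → Y → Prop) [∀ a y, Decidable (P a y)] :
    (A.seedLaw.prod ν).real {ω | P (A.run ω.1) ω.2}
      = ∑ a, A.testLaw a * ∑ y, ν.real {y} * if P a y then 1 else 0 := by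
  classical
  have hpre : ∀ z : ((Fin m → Fin n) → Bool) × Y,
      (fun ω : A.Seed × Y => (A.run ω.1, ω.2)) ⁻¹' {z} = {r | A.run r = z.1} ×ˢ {z.2} := by
    rintro ⟨a, y⟩
    ext ⟨r, y'⟩
    simp [Prod.ext_iff]
  have hmeas : ∀ a, MeasurableSet {r | A.run r = a} := fun a =>
    A.measurable_run' (measurableSet_singleton a)
  have h := sum_measureReal_preimage_singleton (μ := A.seedLaw.prod ν)
    (Finset.univ.filter fun z : ((Fin m → Fin n) → Bool) × Y => P z.1 z.2)
    (f := fun ω : A.Seed × Y => (A.run ω.1, ω.2)) (fun z _ => by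
      rw [hpre]
      exact (hmeas _).prod (measurableSet_singleton _))
  have hset : {ω : A.Seed × Y | P (A.run ω.1) ω.2}
      = (fun ω : A.Seed × Y => (A.run ω.1, ω.2)) ⁻¹'
        ((Finset.univ.filter fun z : ((Fin m → Fin n) → Bool) × Y => P z.1 z.2 : Finset _) :
          Set (((Fin m → Fin n) → Bool) × Y)) := by
    ext ω
    simp
  rw [hset, ← h, Finset.sum_filter, Fintype.sum_prod_type]
  refine Finset.sum_congr rfl fun a _ => ?_
  rw [Finset.mul_sum]
  refine Finset.sum_congr rfl fun y _ => ?_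
  rw [hpre, measureReal_prod_prod]
  simp only [Tester.testLaw]
  split_ifs <;> simp

instance (p : PMF (Fin n)) : IsProbabilityMeasure (sampleLaw p m) := by
  unfold sampleLaw; infer_instance

lemma sampleLaw_real_singleton (p : PMF (Fin n)) (T : Fin m → Fin n) :
    (sampleLaw p m).real {T} = ∏ i, (p (T i)).toReal := by
  rw [measureReal_def, sampleLaw, Measure.pi_singleton, ENNReal.toReal_prod]
  simp

lemma sum_toReal (p : PMF (Fin n)) : ∑ x, (p x).toReal = 1 := by
  rw [← ENNReal.toReal_sum fun x _ => p.apply_ne_top x,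
    ← tsum_fintype (L := .unconditional _), p.tsum_coe]
  rfl

lemma Tester.sum_testLaw (A : Tester.{u} n m) : ∑ a, A.testLaw a = 1 := by
  have h := sum_measureReal_preimage_singleton (μ := A.seedLaw) Finset.univ (f := A.run)
    fun a _ => A.measurable_run' (measurableSet_singleton a)
  rwa [Finset.coe_univ, Set.preimage_univ, probReal_univ] at h

/-- The acceptance probability of a deterministic test. -/
noncomputable def acceptProb (p : PMF (Fin n)) (a : (Fin m → Fin n) → Bool) : ℝ :=
  iidSum (fun x => (p x).toReal) (acceptInd a)

lemma iidSum_reject (p : PMF (Fin n)) (a : (Fin m → Fin n) → Bool) :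
    iidSum (fun x => (p x).toReal) (acceptInd fun T => !a T) = 1 - acceptProb p a := by
  have h := iidSum_add (fun x => (p x).toReal) (acceptInd fun T => !a T) (acceptInd a)
  have e : (fun T => acceptInd (fun T => !a T) T + acceptInd a T) = fun _ => 1 := by
    funext T; unfold acceptInd; cases h : a T <;> simp [h]
  rw [e, iidSum_const (sum_toReal p)] at h
  unfold acceptProb
  linarith

lemma Tester.probAnswer_true (A : Tester.{u} n m) (p : PMF (Fin n)) :
    A.probAnswer p true = ∑ a, A.testLaw a * acceptProb p a := by
  rw [Tester.probAnswer, A.prod_real_eq (sampleLaw p m) fun a T => a T = true]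
  simp only [sampleLaw_real_singleton]
  rfl

lemma Tester.probAnswer_false (A : Tester.{u} n m) (p : PMF (Fin n)) :
    A.probAnswer p false = ∑ a, A.testLaw a * (1 - acceptProb p a) := by
  rw [Tester.probAnswer, A.prod_real_eq (sampleLaw p m) fun a T => a T = false]
  simp only [sampleLaw_real_singleton, ← iidSum_reject]
  refine Finset.sum_congr rfl fun a _ => ?_
  congr 1
  refine Finset.sum_congr rfl fun T _ => ?_
  cases h : a T <;> simp [acceptInd, h]

lemma Tester.agreement_eq (A : Tester.{u} n m) (p : PMF (Fin n)) :
    (A.seedLaw.prod ((sampleLaw p m).prod (sampleLaw p m))).real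
      {ω | A.run ω.1 ω.2.1 = A.run ω.1 ω.2.2}
      = ∑ a, A.testLaw a * (acceptProb p a ^ 2 + (1 - acceptProb p a) ^ 2) := by
  rw [A.prod_real_eq ((sampleLaw p m).prod (sampleLaw p m)) fun a z => a z.1 = a z.2]
  refine Finset.sum_congr rfl fun a _ => ?_
  congr 1
  have hs : ∀ z : (Fin m → Fin n) × (Fin m → Fin n),
      ((sampleLaw p m).prod (sampleLaw p m)).real {z}
        = (∏ i, (p (z.1 i)).toReal) * ∏ i, (p (z.2 i)).toReal := fun z => by
    rw [← sampleLaw_real_singleton, ← sampleLaw_real_singleton, ← measureReal_prod_prod,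
      Set.singleton_prod_singleton]
  simp only [hs]
  rw [← iidSum_reject, sq, sq, acceptProb]
  unfold iidSum
  rw [Finset.sum_mul_sum, Finset.sum_mul_sum, Fintype.sum_prod_type, ← Finset.sum_add_distrib]
  refine Finset.sum_congr rfl fun T _ => ?_
  rw [← Finset.sum_add_distrib]
  refine Finset.sum_congr rfl fun T' _ => ?_
  cases h : a T <;> cases h' : a T' <;> simp [acceptInd, h, h']

end Seeds

/-! ### The hard family on `[n]`: distance to uniform and behaviour near `ξ = 1`. -/

section HardFamily

variable {N e n m : ℕ}

/-- The hard distribution, transported to `[n]`. -/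
noncomputable def hardPMF (φ : Cell N e ≃ Fin n) (hN : 1 ≤ N) {ξ : ℝ} (h0 : 0 ≤ ξ) (h1 : ξ ≤ 1) :
    PMF (Fin n) :=
  PMF.ofFintype (fun y => ENNReal.ofReal (cellWeight ξ (φ.symm y))) (by
    rw [← ENNReal.ofReal_sum_of_nonneg fun y _ => cellWeight_nonneg h0 h1 _,
      φ.symm.sum_comp (cellWeight ξ), sum_cellWeight hN, ENNReal.ofReal_one])

lemma hardPMF_toReal (φ : Cell N e ≃ Fin n) (hN : 1 ≤ N) {ξ : ℝ} (h0 : 0 ≤ ξ) (h1 : ξ ≤ 1)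
    (y : Fin n) : (hardPMF φ hN h0 h1 y).toReal = cellWeight ξ (φ.symm y) := by
  rw [hardPMF, PMF.ofFintype_apply, ENNReal.toReal_ofReal (cellWeight_nonneg h0 h1 _)]

lemma card_eq (φ : Cell N e ≃ Fin n) : (n : ℝ) = 2 * N + e := by
  have := Fintype.card_congr φ
  simp at this
  rw [← this]
  push_cast
  ring

lemma hardPMF_zero [NeZero n] (φ : Cell N e ≃ Fin n) (hN : 1 ≤ N) :
    hardPMF φ hN le_rfl zero_le_one = PMF.uniformOfFintype (Fin n) := by
  ext y
  have hn := card_eq φ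
  have hn0 : (0 : ℝ) < n := by exact_mod_cast Nat.pos_of_ne_zero (NeZero.ne n)
  have : cellWeight 0 (φ.symm y) = (n : ℝ)⁻¹ := by
    rcases φ.symm y with ⟨k, b⟩ | i <;> simp [cellWeight, hn]
  rw [hardPMF, PMF.ofFintype_apply, this, PMF.uniformOfFintype_apply, Fintype.card_fin,
    ENNReal.ofReal_inv_of_pos hn0, ENNReal.ofReal_natCast]

lemma tvDist_hardPMF [NeZero n] (φ : Cell N e ≃ Fin n) (hN : 1 ≤ N) {ξ : ℝ} (h0 : 0 ≤ ξ)
    (h1 : ξ ≤ 1) :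
    tvDist (hardPMF φ hN h0 h1) (PMF.uniformOfFintype (Fin n))
      = 1 / 2 * ∑ x : Cell N e, |cellWeight ξ x - 1 / n| := by
  rw [tvDist, ← φ.sum_comp]
  congr 1
  refine Finset.sum_congr rfl fun x _ => ?_
  rw [hardPMF_toReal, φ.symm_apply_apply, PMF.uniformOfFintype_apply, Fintype.card_fin]
  simp

lemma le_tvDist_hardPMF [NeZero n] (φ : Cell N e ≃ Fin n) (hN : 1 ≤ N) (he : e ≤ 1) {ξ : ℝ}
    (h0 : 0 ≤ ξ) (h1 : ξ ≤ 1) :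
    ξ / 3 ≤ tvDist (hardPMF φ hN h0 h1) (PMF.uniformOfFintype (Fin n)) := by
  have hN' : (1 : ℝ) ≤ N := by exact_mod_cast hN
  have he' : (e : ℝ) ≤ 1 := by exact_mod_cast he
  rw [tvDist_hardPMF, sum_cell]
  have hpair : ∀ k : Fin N, 2 * ξ / n
      ≤ |cellWeight ξ (.inl (k, true) : Cell N e) - 1 / n|
        + |cellWeight ξ (.inl (k, false) : Cell N e) - 1 / n| := fun k => by
    have hd : 2 * ξ / n ≤ cellWeight ξ (.inl (k, true) : Cell N e)
        - cellWeight ξ (.inl (k, false) : Cell N e) := by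
      have : cellWeight ξ (.inl (k, true) : Cell N e) - cellWeight ξ (.inl (k, false) : Cell N e)
          = 2 * ξ * (1 + e * ξ ^ 2 / (2 * N)) / n := by
        rw [card_eq φ]
        simp only [cellWeight, signOf, cond_true, cond_false]
        push_cast
        ring
      rw [this]
      have : (0 : ℝ) ≤ e * ξ ^ 2 / (2 * N) := by positivity
      refine div_le_div_of_nonneg_right ?_ (by positivity)
      nlinarith
    have a1 := le_abs_self (cellWeight ξ (.inl (k, true) : Cell N e) - 1 / n)
    have a2 := neg_abs_le (cellWeight ξ (.inl (k, false) : Cell N e) - 1 / n)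
    linarith
  have hsum := Finset.sum_le_sum fun k (_ : k ∈ Finset.univ) => hpair k
  simp only [Finset.sum_const, Finset.card_univ, Fintype.card_fin, nsmul_eq_mul] at hsum
  have hrest : 0 ≤ ∑ i : Fin e, |cellWeight ξ (.inr i : Cell N e) - 1 / n| :=
    Finset.sum_nonneg fun i _ => abs_nonneg _
  have hmain : 2 * ξ / 3 ≤ N * (2 * ξ / n) := by
    rw [card_eq φ, mul_div_assoc', div_le_div_iff₀ (by norm_num) (by positivity)]
    nlinarith
  linarith

lemma half_le_tvDist_hardPMF_one [NeZero n] (φ : Cell N e ≃ Fin n) (hN : 1 ≤ N) :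
    1 / 2 ≤ tvDist (hardPMF φ hN zero_le_one le_rfl) (PMF.uniformOfFintype (Fin n)) := by
  have hN' : (1 : ℝ) ≤ N := by exact_mod_cast hN
  rw [tvDist_hardPMF, sum_cell]
  have hn := card_eq φ
  have hn0 : (0 : ℝ) < n := by rw [hn]; positivity
  have hpair : ∀ k : Fin N, (1 : ℝ) / N
      ≤ |cellWeight 1 (.inl (k, true) : Cell N e) - 1 / n|
        + |cellWeight 1 (.inl (k, false) : Cell N e) - 1 / n| := fun k => by
    have e1 : cellWeight 1 (.inl (k, true) : Cell N e) = 1 / N := by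
      simp only [cellWeight, signOf, cond_true]
      push_cast
      field_simp
      ring
    have e2 : cellWeight 1 (.inl (k, false) : Cell N e) = 0 := by
      simp [cellWeight, signOf]
    rw [e1, e2]
    have a1 := le_abs_self ((1 : ℝ) / N - 1 / n)
    have a2 := neg_abs_le ((0 : ℝ) - 1 / n)
    linarith
  have hsum := Finset.sum_le_sum fun k (_ : k ∈ Finset.univ) => hpair k
  simp only [Finset.sum_const, Finset.card_univ, Fintype.card_fin, nsmul_eq_mul] at hsum
  have hrest : 0 ≤ ∑ i : Fin e, |cellWeight 1 (.inr i : Cell N e) - 1 / n| :=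
    Finset.sum_nonneg fun i _ => abs_nonneg _
  have : (N : ℝ) * (1 / N) = 1 := by field_simp
  linarith

/-- The acceptance probability of a deterministic test under the hard distribution. -/
noncomputable def hardAccept (φ : Cell N e ≃ Fin n) (ξ : ℝ) (a : (Fin m → Fin n) → Bool) : ℝ :=
  iidSum (cellWeight ξ) fun T => acceptInd a fun i => φ (T i)

lemma acceptProb_hardPMF (φ : Cell N e ≃ Fin n) (hN : 1 ≤ N) {ξ : ℝ} (h0 : 0 ≤ ξ) (h1 : ξ ≤ 1)
    (a : (Fin m → Fin n) → Bool) :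
    acceptProb (hardPMF φ hN h0 h1) a = hardAccept φ ξ a := by
  unfold acceptProb hardAccept iidSum
  rw [← (Equiv.arrowCongr (Equiv.refl (Fin m)) φ).sum_comp]
  refine Finset.sum_congr rfl fun T _ => ?_
  have hT : (Equiv.arrowCongr (Equiv.refl (Fin m)) φ) T = fun i => φ (T i) := rfl
  simp only [hT, hardPMF_toReal, φ.symm_apply_apply]

lemma acceptInd_nonneg {Y : Type*} (a : Y → Bool) (T : Y) : 0 ≤ acceptInd a T := by
  unfold acceptInd; split_ifs <;> norm_num

lemma acceptInd_le_one {Y : Type*} (a : Y → Bool) (T : Y) : acceptInd a T ≤ 1 := by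
  unfold acceptInd; split_ifs <;> norm_num

lemma hardAccept_nonneg (φ : Cell N e ≃ Fin n) {ξ : ℝ} (h0 : 0 ≤ ξ) (h1 : ξ ≤ 1)
    (a : (Fin m → Fin n) → Bool) : 0 ≤ hardAccept φ ξ a :=
  iidSum_nonneg (cellWeight_nonneg h0 h1) fun _ => acceptInd_nonneg _ _

lemma hardAccept_le_one (φ : Cell N e ≃ Fin n) (hN : 1 ≤ N) {ξ : ℝ} (h0 : 0 ≤ ξ) (h1 : ξ ≤ 1)
    (a : (Fin m → Fin n) → Bool) : hardAccept φ ξ a ≤ 1 := by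
  rw [← iidSum_const (sum_cellWeight (N := N) (e := e) hN ξ) (m := m) 1]
  exact iidSum_mono (cellWeight_nonneg h0 h1) fun _ => acceptInd_le_one _ _

/-- One factor `ξ` comes from `2 ξ ≤ 1 + ξ`, two more from the correction for the leftover mass; the
other elements have weight zero at `ξ = 1`. -/
lemma cellWeight_one_le (hN : 1 ≤ N) {ξ : ℝ} (h0 : 0 ≤ ξ) (h1 : ξ ≤ 1) (x : Cell N e) :
    ξ ^ 3 * cellWeight 1 x ≤ cellWeight ξ x := by
  have hN' : (1 : ℝ) ≤ N := by exact_mod_cast hN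
  have hnn := cellWeight_nonneg h0 h1 x
  rcases x with ⟨k, b⟩ | i
  · cases b
    · simpa [cellWeight, signOf] using hnn
    · simp only [cellWeight, signOf, cond_true, mul_div_assoc']
      push_cast
      have h2 : ξ ^ 2 * (1 + (e : ℝ) * 1 ^ 2 / (2 * N)) ≤ 1 + e * ξ ^ 2 / (2 * N) := by
        have : ξ ^ 2 * (1 + (e : ℝ) * 1 ^ 2 / (2 * N)) = ξ ^ 2 + e * ξ ^ 2 / (2 * N) := by ring
        rw [this]
        nlinarith
      have h3 : ξ * (1 + 1 * 1) ≤ 1 + 1 * ξ := by linarith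
      refine div_le_div_of_nonneg_right ?_ (by positivity)
      calc ξ ^ 3 * ((1 + 1 * 1) * (1 + (e : ℝ) * 1 ^ 2 / (2 * N)))
          = (ξ * (1 + 1 * 1)) * (ξ ^ 2 * (1 + (e : ℝ) * 1 ^ 2 / (2 * N))) := by ring
        _ ≤ _ := mul_le_mul h3 h2 (by positivity) (by positivity)
  · simpa [cellWeight] using hnn

/-- A test that rejects the extreme distribution `ξ = 1` rejects those with `ξ` close to `1`. -/
lemma one_sub_hardAccept_ge (φ : Cell N e ≃ Fin n) (hN : 1 ≤ N) {ξ : ℝ} (h0 : 0 ≤ ξ) (h1 : ξ ≤ 1)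
    (a : (Fin m → Fin n) → Bool) :
    (1 - m * (3 * (1 - ξ))) * (1 - hardAccept φ 1 a) ≤ 1 - hardAccept φ ξ a := by
  have hrej : ∀ ζ : ℝ, 1 - hardAccept φ ζ a
      = iidSum (cellWeight ζ) fun T : Fin m → Cell N e => 1 - acceptInd a fun i => φ (T i) := by
    intro ζ
    have h := iidSum_add (cellWeight ζ)
      (fun T : Fin m → Cell N e => 1 - acceptInd a fun i => φ (T i)) fun T => acceptInd a fun i => φ (T i)
    simp only [sub_add_cancel, iidSum_const (sum_cellWeight (N := N) (e := e) hN ζ)] at h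
    unfold hardAccept
    linarith
  -- The product law at `ξ` dominates `ξ ^ (3 m)` times that at `1`; Bernoulli's inequality makes
  -- this factor linear.
  have hpow : 1 - m * (3 * (1 - ξ)) ≤ (ξ ^ 3) ^ m := by
    have hc : 1 - 3 * (1 - ξ) ≤ ξ ^ 3 := by
      nlinarith [mul_nonneg (sq_nonneg (ξ - 1)) (by linarith : 0 ≤ ξ + 2)]
    have := one_add_mul_le_pow (a := ξ ^ 3 - 1) (by nlinarith [pow_nonneg h0 3]) m
    rw [add_sub_cancel] at this
    refine le_trans ?_ this
    nlinarith [mul_le_mul_of_nonneg_left hc (Nat.cast_nonneg (α := ℝ) m)]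
  refine (mul_le_mul_of_nonneg_right hpow
    (sub_nonneg.2 (hardAccept_le_one φ hN zero_le_one le_rfl a))).trans ?_
  rw [hrej, hrej]
  unfold iidSum
  rw [Finset.mul_sum]
  refine Finset.sum_le_sum fun T _ => ?_
  rw [← mul_assoc]
  refine mul_le_mul_of_nonneg_right ?_ (sub_nonneg.2 (acceptInd_le_one _ _))
  calc (ξ ^ 3) ^ m * ∏ i, cellWeight 1 (T i) = ∏ i, (ξ ^ 3 * cellWeight 1 (T i)) := by
        rw [Finset.prod_mul_distrib]; simp
    _ ≤ _ := Finset.prod_le_prod (fun i _ => mul_nonneg (by positivity)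
        (cellWeight_nonneg zero_le_one le_rfl _)) fun i _ => cellWeight_one_le hN h0 h1 _

end HardFamily

/-! ### From the gap inequality to the sample bound. -/

section LowerBound

variable {N e n m : ℕ}

/-- A flip is a relabelling of `[n]`. Positive probability is needed to know that `a` is the test of
some seed, hence symmetric. -/
lemma acceptInd_flip (A : Tester.{u} n m) (hsym : A.Symmetric) (φ : Cell N e ≃ Fin n)
    {a : (Fin m → Fin n) → Bool} (ha : A.testLaw a ≠ 0) (j : Fin N) (T : Fin m → Cell N e) :
    acceptInd a (fun i => φ (flip j (T i))) = acceptInd a fun i => φ (T i) := by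
  have hne : {r | A.run r = a}.Nonempty := by
    by_contra h
    rw [Set.not_nonempty_iff_eq_empty] at h
    exact ha (by rw [Tester.testLaw, h, measureReal_empty])
  obtain ⟨r, rfl⟩ := hne
  have h := hsym r ((φ.symm.trans (flip j)).trans φ) fun i => φ (T i)
  simp only [Equiv.trans_apply, φ.symm_apply_apply] at h
  unfold acceptInd
  rw [h]

/-- Replicability forces the hard family to be long, as measured by the number of samples. -/
theorem sq_gap_le [NeZero n] (A : Tester.{u} n m) (hsym : A.Symmetric) {ρ : ℝ}
    (hrep : A.Replicable ρ) (φ : Cell N e ≃ Fin n) (hN : 1 ≤ N) (he : e ≤ 1) {s D : ℝ}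
    (hs : 0 ≤ s) (hD : 0 ≤ D)
    (hgap : D ≤ ∑ a, A.testLaw a * (hardAccept φ 0 a - hardAccept φ (Real.tanh s) a)) :
    D ^ 2 ≤ 3 * √(m * (72 * min 1 (min s 1 ^ 2 * (m / N)))) * ρ * s := by
  refine sq_le_of_replicable A.testLaw A.testLaw_nonneg A.sum_testLaw
    (fun a t => hardAccept φ (Real.tanh t) a)
    (fun a t => iidSum (cellWeight (Real.tanh t)) fun T =>
      statistic t T * acceptInd a fun i => φ (T i)) hs hD ?_ ?_ ?_ ?_ ?_ ?_
  · intro a ha t _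
    exact hasDerivAt_iidSum hN t _ fun j T => acceptInd_flip A hsym φ ha j T
  · intro a _ t ht
    refine Real.abs_le_sqrt ((sq_iidSum_statistic_mul_le hN he ht.1 _ fun T => ?_).trans ?_)
    · exact pow_le_one₀ (acceptInd_nonneg _ _) (acceptInd_le_one _ _)
    · have : min t 1 ≤ min s 1 := min_le_min_right 1 ht.2
      have : 0 ≤ min t 1 := le_min ht.1 zero_le_one
      gcongr
  · intro a t ht
    exact hardAccept_nonneg φ (tanh_nonneg ht.1) (Real.tanh_lt_one t).le a
  · intro a t ht
    exact hardAccept_le_one φ hN (tanh_nonneg ht.1) (Real.tanh_lt_one t).le a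
  · intro t ht
    have h := hrep (hardPMF φ hN (tanh_nonneg ht.1) (Real.tanh_lt_one t).le)
    rw [A.agreement_eq] at h
    simpa only [acceptProb_hardPMF] using h
  · simpa using hgap

/-- Each branch of `min` yields one term of the bound: `1` gives the term without `n`, the other
gives the `√n` term. Only the path length carries `ℓ`; the capped `min s 1` stays of order `ε`. -/
lemma samples_ge_of_sq_gap_le {ρ ε D K ℓ s : ℝ} (hρ : 0 < ρ) (hε : 0 < ε) (hD : 0 < D)
    (hK : 0 < K) (hℓ : 1 ≤ ℓ) (hs : 0 ≤ s) (hN : 1 ≤ N) (hn : (n : ℝ) ≤ 3 * N)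
    (hsK : s ≤ K * ε * ℓ) (hsK1 : min s 1 ≤ K * ε)
    (h : D ^ 2 ≤ 3 * √(m * (72 * min 1 (min s 1 ^ 2 * (m / N)))) * ρ * s) :
    √n / (ε ^ 2 * ρ) + 1 / (ρ ^ 2 * ε ^ 2)
      ≤ K ^ 2 * (45 / D ^ 2 + 648 / D ^ 4) * (m * ℓ ^ 2) := by
  have hN' : (1 : ℝ) ≤ N := by exact_mod_cast hN
  have hm : (0 : ℝ) ≤ m := by positivity
  have hmin : 0 ≤ min s 1 := le_min hs zero_le_one
  have h1 : (D ^ 2) ^ 2 ≤ 9 * (m * 72) * ρ ^ 2 * (K * ε * ℓ) ^ 2 := by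
    have hb : 3 * √(m * (72 * min 1 (min s 1 ^ 2 * (m / N)))) * ρ * s
        ≤ 3 * √(m * 72) * ρ * (K * ε * ℓ) := by
      gcongr
      nlinarith [min_le_left 1 (min s 1 ^ 2 * (m / N))]
    refine (pow_le_pow_left₀ (by positivity) (h.trans hb) 2).trans_eq ?_
    rw [mul_pow, mul_pow, mul_pow, Real.sq_sqrt (by positivity)]
    ring
  have h2 : (D ^ 2 * √n) ^ 2 ≤ (45 * m * K ^ 2 * ε ^ 2 * ρ * ℓ) ^ 2 := by
    have hb : 3 * √(m * (72 * min 1 (min s 1 ^ 2 * (m / N)))) * ρ * s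
        ≤ 3 * √(m * (72 * ((K * ε) ^ 2 * (m / N)))) * ρ * (K * ε * ℓ) := by
      have : min 1 (min s 1 ^ 2 * (m / N : ℝ)) ≤ (K * ε) ^ 2 * (m / N) :=
        (min_le_right _ _).trans (by gcongr)
      gcongr
    have h3 := pow_le_pow_left₀ (by positivity) (h.trans hb) 2
    rw [mul_pow _ (K * ε * ℓ), mul_pow _ ρ, mul_pow 3, Real.sq_sqrt (by positivity)] at h3
    rw [mul_pow, Real.sq_sqrt (by positivity)]
    calc (D ^ 2) ^ 2 * n
        ≤ (3 ^ 2 * (m * (72 * ((K * ε) ^ 2 * (m / N)))) * ρ ^ 2 * (K * ε * ℓ) ^ 2) * (3 * N) := by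
          gcongr
      _ = 1944 * (m * K ^ 2 * ε ^ 2 * ρ * ℓ) ^ 2 := by field_simp; ring
      -- `1944 = 9 * 72 * 3` is rounded up to `45 ^ 2`.
      _ ≤ 2025 * (m * K ^ 2 * ε ^ 2 * ρ * ℓ) ^ 2 := by gcongr; norm_num
      _ = _ := by ring
  have h2' := abs_le_of_sq_le_sq h2 (by positivity)
  have h4 : √n / (ε ^ 2 * ρ) ≤ K ^ 2 * (45 / D ^ 2) * (m * ℓ ^ 2) := by
    have e1 : K ^ 2 * (45 / D ^ 2) * (m * ℓ ^ 2) = 45 * m * K ^ 2 * ℓ ^ 2 / D ^ 2 := by ring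
    rw [e1, div_le_div_iff₀ (by positivity) (by positivity)]
    calc √n * D ^ 2 ≤ 45 * m * K ^ 2 * ε ^ 2 * ρ * ℓ := by
          rw [mul_comm]; exact (le_abs_self _).trans h2'
      _ ≤ 45 * m * K ^ 2 * ε ^ 2 * ρ * ℓ ^ 2 := by gcongr; nlinarith
      _ = _ := by ring
  have h5 : 1 / (ρ ^ 2 * ε ^ 2) ≤ K ^ 2 * (648 / D ^ 4) * (m * ℓ ^ 2) := by
    have e1 : K ^ 2 * (648 / D ^ 4) * (m * ℓ ^ 2) = 648 * m * K ^ 2 * ℓ ^ 2 / D ^ 4 := by ring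
    rw [e1, div_le_div_iff₀ (by positivity) (by positivity)]
    nlinarith
  linarith [h4, h5, mul_add (K ^ 2) (45 / D ^ 2) (648 / D ^ 4),
    add_mul (K ^ 2 * (45 / D ^ 2)) (K ^ 2 * (648 / D ^ 4)) (m * ℓ ^ 2)]

lemma gap_of_far [NeZero n] (A : Tester.{u} n m) {ε ρ : ℝ} (hA : A.SolvesUniformity ε ρ)
    (φ : Cell N e ≃ Fin n) (hN : 1 ≤ N) {ξ : ℝ} (h0 : 0 ≤ ξ) (h1 : ξ ≤ 1)
    (hfar : ε ≤ tvDist (hardPMF φ hN h0 h1) (PMF.uniformOfFintype (Fin n))) :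
    1 - ρ ≤ ∑ a, A.testLaw a * hardAccept φ 0 a ∧
      1 - ρ ≤ ∑ a, A.testLaw a * (1 - hardAccept φ ξ a) := by
  have ha := hA.accepts
  have hr := hA.rejects _ hfar
  rw [← hardPMF_zero φ hN, A.probAnswer_true] at ha
  rw [A.probAnswer_false] at hr
  simp only [acceptProb_hardPMF] at ha hr
  exact ⟨ha, hr⟩

lemma artanh_le {ξ : ℝ} (h0 : 0 ≤ ξ) (h1 : ξ ≤ 3 / 4) : Real.artanh ξ ≤ 4 * ξ := by
  rw [Real.artanh_eq_half_log ⟨by linarith, by linarith⟩]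
  have h := Real.log_le_sub_one_of_pos (div_pos (by linarith) (by linarith) :
    0 < (1 + ξ) / (1 - ξ))
  have : (1 + ξ) / (1 - ξ) ≤ 1 + 8 * ξ := by
    rw [div_le_iff₀ (by linarith)]
    nlinarith
  linarith

end LowerBound

/-! ### The regimes of small and large `ε`. -/

section LowerBound

variable {n m : ℕ}

/-- The cells of `[n]`, for `n = 2 (n / 2) + n % 2`. -/
noncomputable def cellEquiv (n : ℕ) : Cell (n / 2) (n % 2) ≃ Fin n :=
  Fintype.equivFinOfCardEq (by
    simp only [Fintype.card_sum, Fintype.card_prod, Fintype.card_fin, Fintype.card_bool]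
    omega)

/-- The lower bound for proximity parameters below `1 / 4`. -/
lemma samples_ge_of_small [NeZero n] (hn : 2 ≤ n) (A : Tester.{u} n m) (hsym : A.Symmetric)
    {ε ρ D ℓ : ℝ} (hA : A.SolvesUniformity ε ρ) (hε : 0 < ε) (hε4 : ε < 1 / 4) (hρ : 0 < ρ)
    (hD : 0 < D) (hDρ : 2 * D ≤ 1 - 2 * ρ) (hℓ : 1 ≤ ℓ) {K : ℝ} (hK : 12 ≤ K) :
    √n / (ε ^ 2 * ρ) + 1 / (ρ ^ 2 * ε ^ 2)
      ≤ K ^ 2 * (45 / D ^ 2 + 648 / D ^ 4) * (m * ℓ ^ 2) := by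
  have hN : 1 ≤ n / 2 := by omega
  have he : n % 2 ≤ 1 := by omega
  have h3N : (n : ℝ) ≤ 3 * (n / 2 : ℕ) := by
    have : n ≤ 3 * (n / 2) := by omega
    exact_mod_cast this
  -- Bias `3 ε` guarantees distance `ε`, and `ε < 1 / 4` keeps it below `3 / 4`, where `artanh_le`
  -- gives `s ≤ 12 ε`; hence `12 ≤ K`.
  set s := Real.artanh (3 * ε) with hsdef
  have hs : 0 ≤ s := Real.artanh_nonneg (by linarith)
  have htanh : Real.tanh s = 3 * ε := Real.tanh_artanh ⟨by linarith, by linarith⟩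
  have hs12 : s ≤ K * ε := (artanh_le (by linarith) (by linarith)).trans (by nlinarith)
  have hξ0 : 0 ≤ 3 * ε := by linarith
  have hξ1 : 3 * ε ≤ 1 := by linarith
  have hfar := le_tvDist_hardPMF (cellEquiv n) hN he hξ0 hξ1
  rw [mul_div_cancel_left₀ ε three_ne_zero] at hfar
  obtain ⟨g0, g1⟩ := gap_of_far A hA (cellEquiv n) hN hξ0 hξ1 hfar
  refine samples_ge_of_sq_gap_le hρ hε hD (by linarith) hℓ hs hN h3N ?_
    ((min_le_left _ _).trans hs12)
    (sq_gap_le A hsym hA.replicable (cellEquiv n) hN he hs hD.le ?_)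
  · nlinarith [mul_pos (by linarith : 0 < K) hε]
  · rw [htanh]
    simp only [mul_sub, mul_one, Finset.sum_sub_distrib, A.sum_testLaw] at g1 ⊢
    linarith

/-- The lower bound for proximity parameters above `1 / 4`, given that the hard family up to time
`s` almost reaches the extreme distribution. -/
lemma samples_ge_of_large [NeZero n] (hn : 2 ≤ n) (A : Tester.{u} n m) (hsym : A.Symmetric)
    {ε ρ D ℓ s : ℝ} (hA : A.SolvesUniformity ε ρ) (hε4 : 1 / 4 ≤ ε) (hε2 : ε < 1 / 2) (hρ : 0 < ρ)
    (hD : 0 < D) (hDρ : 2 * D ≤ 1 - 2 * ρ) (hℓ : 1 ≤ ℓ) {K : ℝ} (hK : 4 ≤ K) (hs : 0 ≤ s)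
    (hsK : 4 * s ≤ K * ℓ) (hsD : m * (3 * (1 - Real.tanh s)) ≤ D) :
    √n / (ε ^ 2 * ρ) + 1 / (ρ ^ 2 * ε ^ 2)
      ≤ K ^ 2 * (45 / D ^ 2 + 648 / D ^ 4) * (m * ℓ ^ 2) := by
  have hN : 1 ≤ n / 2 := by omega
  have he : n % 2 ≤ 1 := by omega
  have h3N : (n : ℝ) ≤ 3 * (n / 2 : ℕ) := by
    have : n ≤ 3 * (n / 2) := by omega
    exact_mod_cast this
  obtain ⟨g0, g1⟩ := gap_of_far A hA (cellEquiv n) hN zero_le_one le_rfl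
    (hε2.le.trans (half_le_tvDist_hardPMF_one (cellEquiv n) hN))
  refine samples_ge_of_sq_gap_le hρ (by linarith) hD (by linarith) hℓ hs hN h3N ?_
    ((min_le_right _ _).trans (by nlinarith))
    (sq_gap_le A hsym hA.replicable (cellEquiv n) hN he hs hD.le ?_)
  · nlinarith [mul_pos (by linarith : 0 < K) (by linarith : 0 < ℓ)]
  · have hrej : (1 - D) * ∑ a, A.testLaw a * (1 - hardAccept (cellEquiv n) 1 a)
        ≤ ∑ a, A.testLaw a * (1 - hardAccept (cellEquiv n) (Real.tanh s) a) := by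
      rw [Finset.mul_sum]
      refine Finset.sum_le_sum fun a _ => ?_
      rw [mul_left_comm]
      refine mul_le_mul_of_nonneg_left (le_trans (mul_le_mul_of_nonneg_right ?_ ?_)
        (one_sub_hardAccept_ge (cellEquiv n) hN (tanh_nonneg hs) (Real.tanh_lt_one s).le a))
        (A.testLaw_nonneg a)
      · linarith
      · exact sub_nonneg.2 (hardAccept_le_one _ hN zero_le_one le_rfl a)
    have hD1 : 0 ≤ 1 - D := by linarith
    have h2 := mul_le_mul_of_nonneg_left g1 hD1
    have h3 : 1 - ρ - D ≤ ∑ a, A.testLaw a * (1 - hardAccept (cellEquiv n) (Real.tanh s) a) := by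
      nlinarith [mul_pos hD hρ]
    simp only [mul_sub, mul_one, Finset.sum_sub_distrib, A.sum_testLaw] at h3 ⊢
    linarith

/-- A time at which the hard family almost reaches the extreme distribution. -/
lemma exists_time {D x ℓ : ℝ} (hD : 0 < D) (hx : 1 ≤ x) (hℓ : 1 ≤ ℓ) (hℓx : ℓ = Real.log x)
    (hm : (m : ℝ) ≤ 32 * x ^ 2) :
    ∃ s, 0 ≤ s ∧ 4 * s ≤ (4 * Real.log (33 * (6 / D + 1)) + 12) * ℓ ∧
      m * (3 * (1 - Real.tanh s)) ≤ D := by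
  set κ := 6 / D + 1 with hκ
  have hκ1 : 1 ≤ κ := by rw [hκ]; linarith [div_pos (by norm_num : (0 : ℝ) < 6) hD]
  have hm0 : (0 : ℝ) ≤ m := by positivity
  have hpos : 1 ≤ κ * (m + 1) := by nlinarith
  have hlog0 : 0 ≤ Real.log (33 * κ) := Real.log_nonneg (by linarith)
  -- At this `s`, `1 - tanh s ≤ 2 / (κ (m + 1))`, so `κ ≥ 6 / D` is enough; the extra `1` in `κ`
  -- keeps the logarithm nonnegative.
  refine ⟨Real.log (κ * (m + 1)) / 2, by linarith [Real.log_nonneg hpos], ?_, ?_⟩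
  · have h1 : κ * (m + 1) ≤ (33 * κ) * x ^ 2 := by
      have : (m : ℝ) + 1 ≤ 33 * x ^ 2 := by nlinarith
      nlinarith
    have h2 := Real.log_le_log (by linarith) h1
    rw [Real.log_mul (x := 33 * κ) (by positivity) (by positivity), Real.log_pow, ← hℓx] at h2
    push_cast at h2
    nlinarith
  · have h1 := one_sub_tanh_le (Real.log (κ * (m + 1)) / 2)
    rw [mul_div_cancel₀ _ (two_ne_zero), Real.exp_neg, Real.exp_log (by linarith)] at h1
    calc m * (3 * (1 - Real.tanh (Real.log (κ * (m + 1)) / 2)))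
        ≤ m * (3 * (2 * (κ * (m + 1))⁻¹)) := by gcongr
      _ = 6 * m / (κ * (m + 1)) := by field_simp; ring
      _ ≤ D := by
          rw [div_le_iff₀ (by linarith)]
          have h2 : D * κ = 6 + D := by rw [hκ]; field_simp
          rw [← mul_assoc, h2]
          nlinarith

end LowerBound

end RepUnif

/-! ### Choice of constants and assembly. -/

theorem theorem2 :
    ∃ k : ℕ, ∀ ρ₀ : ℝ, ρ₀ < 1 / 2 → ∃ c : ℝ, 0 < c ∧
      ∀ (n : ℕ) [NeZero n], 2 ≤ n →
      ∀ ε ρ : ℝ, 0 < ε → ε < 1 / 2 → 0 < ρ → ρ ≤ ρ₀ →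
      ∀ (m : ℕ) (A : RepUnif.Tester.{u} n m), A.Symmetric → A.SolvesUniformity ε ρ →
        c * (Real.sqrt n / (ε ^ 2 * ρ) + 1 / (ρ ^ 2 * ε ^ 2)) / Real.log (n / ρ) ^ k ≤ (m : ℝ) := by
  refine ⟨2, fun ρ₀ hρ₀ => ?_⟩
  obtain ⟨D, hDdef⟩ : ∃ D, D = (1 - 2 * ρ₀) / 2 := ⟨_, rfl⟩
  have hD : 0 < D := by linarith
  obtain ⟨K, hKdef⟩ : ∃ K, K = 4 * Real.log (33 * (6 / D + 1)) + 12 := ⟨_, rfl⟩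
  have hK : 12 ≤ K := by
    have : 0 ≤ Real.log (33 * (6 / D + 1)) :=
      Real.log_nonneg (by linarith [div_pos (by norm_num : (0 : ℝ) < 6) hD])
    linarith
  obtain ⟨C, hCdef⟩ : ∃ C, C = K ^ 2 * (45 / D ^ 2 + 648 / D ^ 4) := ⟨_, rfl⟩
  have hC : 0 < C := by rw [hCdef]; positivity
  refine ⟨min 1 C⁻¹, by positivity, fun n _ hn ε ρ hε hε2 hρ hρρ m A hsym hA => ?_⟩
  have hn' : (2 : ℝ) ≤ n := by exact_mod_cast hn
  have hDρ : 2 * D ≤ 1 - 2 * ρ := by linarith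
  have hx : 4 ≤ n / ρ := by
    rw [le_div_iff₀ hρ]; linarith
  obtain ⟨ℓ, hℓdef⟩ : ∃ ℓ, ℓ = Real.log (n / ρ) := ⟨_, rfl⟩
  have hℓ : 1 ≤ ℓ := by
    rw [hℓdef, Real.le_log_iff_exp_le (by linarith)]
    linarith [Real.exp_one_lt_d9]
  rw [← hℓdef, div_le_iff₀ (by positivity)]
  obtain ⟨Q, hQdef⟩ : ∃ Q, Q = √n / (ε ^ 2 * ρ) + 1 / (ρ ^ 2 * ε ^ 2) := ⟨_, rfl⟩
  have hQ : 0 ≤ Q := by rw [hQdef]; positivity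
  rw [← hQdef]
  -- If `m ≥ Q` the claim holds since `ℓ ≥ 1`. Otherwise `m < Q` makes `m` polynomial in `n / ρ`
  -- when `ε ≥ 1 / 4`, so a stopping time logarithmic in `m` is `O(ℓ)`.
  by_cases hmQ : Q ≤ m
  · have hm0 : (0 : ℝ) ≤ m := by positivity
    calc min 1 C⁻¹ * Q ≤ 1 * Q := mul_le_mul_of_nonneg_right (min_le_left _ _) hQ
      _ ≤ m := by linarith
      _ ≤ m * ℓ ^ 2 := le_mul_of_one_le_right hm0 (one_le_pow₀ hℓ)
  suffices h : Q ≤ C * (m * ℓ ^ 2) by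
    calc min 1 C⁻¹ * Q ≤ C⁻¹ * Q := mul_le_mul_of_nonneg_right (min_le_right _ _) hQ
      _ ≤ C⁻¹ * (C * (m * ℓ ^ 2)) := by gcongr
      _ = m * ℓ ^ 2 := by field_simp
  rw [hQdef, hCdef]
  rcases lt_or_ge ε (1 / 4) with hε4 | hε4
  · exact RepUnif.samples_ge_of_small hn A hsym hA hε hε4 hρ hD hDρ hℓ hK
  · have hm : (m : ℝ) ≤ 32 * (n / ρ) ^ 2 := by
      refine (lt_of_not_ge hmQ).le.trans ?_
      have hρ1 : ρ ≤ 1 := by linarith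
      have hsq : √n ≤ (n : ℝ) ^ 2 := by
        rw [Real.sqrt_le_left (by positivity)]
        have h1 : (1 : ℝ) ≤ n := by linarith
        calc (n : ℝ) = n ^ 1 := (pow_one _).symm
          _ ≤ n ^ 4 := pow_le_pow_right₀ h1 (by norm_num)
          _ = (n ^ 2) ^ 2 := by ring
      have hεsq : 1 / 16 ≤ ε ^ 2 := by nlinarith
      have e1 : Q = (√n * ρ + 1) / (ε ^ 2 * ρ ^ 2) := by rw [hQdef]; field_simp
      have h1 : √n * ρ ≤ (n : ℝ) ^ 2 := by nlinarith [Real.sqrt_nonneg (n : ℝ)]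
      rw [e1, div_pow, mul_div_assoc', div_le_div_iff₀ (by positivity) (by positivity)]
      have h2 : 0 ≤ (n : ℝ) ^ 2 * ρ ^ 2 := by positivity
      have h3 : √n * ρ + 1 ≤ 2 * (n : ℝ) ^ 2 := by nlinarith
      nlinarith [mul_le_mul_of_nonneg_right h3 (sq_nonneg ρ)]
    obtain ⟨s, hs, hsK, hsD⟩ := RepUnif.exists_time hD (by linarith) hℓ hℓdef hm
    rw [← hKdef] at hsK
    exact RepUnif.samples_ge_of_large hn A hsym hA hε4 hε2 hρ hD hDρ hℓ (by linarith) hs hsK hsD
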